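/- Let $\mathcal H_{\rm hol}$ be the Bargmann space of entire functions $f$ with $\int_{\mathbb C}|f|^2\,d\mu<\infty$, where $d\mu(w)=\pi^{-1}e^{-|w|^2}\,du\,dv$ $(w=u+iv)$, with the inner product of $L^2(\mathbb C,\mu)$ and the orthonormal basis $\Phi_n(z)=z^n/\sqrt{n!}$, $n\ge 0$. For $w\in\mathbb C$ let $\eta_{\bar w}=e^{-|w|^2/2}\sum_{n\ge0}\overline{\Phi_n(w)}\,\Phi_n$ be the canonical coherent state (the series converges in $\mathcal H_{\rm hol}$). For $\xi\in\mathbb C$ let $K_+=\frac12z^2$, $K_-=\frac12\partial_z^2$, and let $S(\xi)=e^{\xi K_+-\bar\xi K_-}$ be the squeeze operator, i.e. $S(\xi)=U(1)$ for a strongly continuous one-parameter unitary group $(U(t))_{t\in\mathbb R}$ on $\mathcal H_{\rm hol}$ whose infinitesimal generator (the derivative at $t=0$) is the closure of $\xi K_+-\bar\xi K_-$ on the polynomials. Put $\Phi_n^\xi=S(\xi)\Phi_n$, $\eta^\xi_{\bar w}=S(\xi)\eta_{\bar w}$, and $\zeta=\frac{\tanh|\xi|}{|\xi|}\,\xi$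 (with $\zeta=0$ if $\xi=0$), and $$S^\xi(z,\bar w)=(1-|\zeta|^2)^{1/4}\,e^{\frac12(\zeta z^2-\bar\zeta\bar w^2)}\,e^{\sqrt{1-|\zeta|^2}\,z\bar w},\qquad z,w\in\mathbb C .$$ Then for every $\xi\in\mathbb C$ the unitary operator $S(\xi)$ exists and is unique, and: 1. $S(\xi)$ is the integral operator with kernel $S^\xi$: for all $f\in\mathcal H_{\rm hol}$ and $z\in\mathbb C$, the function $w\mapsto S^\xi(z,\bar w)f(w)$ is $\mu$-integrable and $$(S(\xi)f)(z)=\frac1\pi\int_{\mathbb C}S^\xi(z,\bar w)\,f(w)\,e^{-|w|^2}\,du\,dv ;$$ moreover $S^\xi(z,\bar w)=\sum_{n=0}^\infty\Phi_n^\xi(z)\,\overline{\Phi_n(w)}$ for all $z,w\in\mathbb C$. 2. The squeezed coherent states are $\eta^\xi_{\bar w}(z)=e^{-|w|^2/2}\,S^\xi(z,\bar w)$ for all $z,w\in\mathbb C$. -/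

import Mathlib

open MeasureTheory ComplexConjugate Polynomial

noncomputable section

/-! ### Exponential of an essentially skew-adjoint operator -/

section UnitaryGroup

variable {E : Type*} [NormedAddCommGroup E] [InnerProductSpace ℂ E]

/-- A strongly continuous one-parameter group of unitary operators. -/
structure IsUnitaryGroup (U : ℝ → (E ≃ₗᵢ[ℂ] E)) : Prop where
  map_zero : ∀ f, U 0 f = f
  map_add : ∀ s t f, U (s + t) f = U s (U t f)
  continuous : ∀ f, Continuous fun t => U t f

/-- The graph of the infinitesimal generator of `U`: the pairs `(f, g)` such that
`(U t f - f) / t` tends to `g` in norm as `t → 0`. -/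
def generatorGraph (U : ℝ → (E ≃ₗᵢ[ℂ] E)) : Set (E × E) :=
  {p | HasDerivAt (fun t : ℝ => U t p.1) p.2 0}

/-- `S = exp A`, where `A` is a densely defined, possibly unbounded operator, given by its graph:
`S = U 1` for a strongly continuous one-parameter unitary group `U` whose generator is the
closure of `A`. -/
def IsUnitaryExp (A : Set (E × E)) (S : E ≃ₗᵢ[ℂ] E) : Prop :=
  ∃ U : ℝ → (E ≃ₗᵢ[ℂ] E), IsUnitaryGroup U ∧ generatorGraph U = closure A ∧ U 1 = S

open Classical in
/-- The unitary operator `exp A` (the identity if there is none). -/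
def unitaryExp (A : Set (E × E)) : E ≃ₗᵢ[ℂ] E :=
  if h : ∃ S, IsUnitaryExp A S then h.choose else LinearIsometryEquiv.refl ℂ E

end UnitaryGroup

/-! ### The Bargmann space -/

/-- The measure `π⁻¹ exp (-|z|²) dx dy` on the complex plane. -/
def bargmannMeasure : Measure ℂ :=
  volume.withDensity fun z => ENNReal.ofReal (Real.pi⁻¹ * Real.exp (-‖z‖ ^ 2))

/-- The entire functions which are square integrable for `π⁻¹ exp (-|z|²) dx dy`. -/
def bargmannSubmodule : Submodule ℂ (ℂ → ℂ) where
  carrier := {f | Differentiable ℂ f ∧ MemLp f 2 bargmannMeasure}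
  add_mem' hf hg := ⟨hf.1.add hg.1, hf.2.add hg.2⟩
  zero_mem' := ⟨differentiable_const 0, MemLp.zero⟩
  smul_mem' c _ hf := ⟨hf.1.const_smul c, hf.2.const_smul c⟩

/-- The Bargmann space. Below it gets the inner product `⟪f, g⟫ = ∫ conj (f z) * g z` of
`L²(ℂ, π⁻¹ exp (-|z|²) dx dy)`, and not the topology of pointwise convergence. -/
def Bargmann : Type := bargmannSubmodule

namespace Bargmann

instance : AddCommGroup Bargmann := inferInstanceAs (AddCommGroup bargmannSubmodule)

instance : Module ℂ Bargmann := inferInstanceAs (Module ℂ bargmannSubmodule)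

instance : CoeFun Bargmann fun _ => ℂ → ℂ := ⟨fun f => f.1⟩

@[ext]
theorem ext {f g : Bargmann} (h : ∀ z, f z = g z) : f = g := Subtype.ext (funext h)

/-- The inclusion of the Bargmann space into `L²`. -/
def toL2 : Bargmann →ₗ[ℂ] Lp ℂ 2 bargmannMeasure where
  toFun f := f.2.2.toLp f.1
  map_add' _ _ := rfl
  map_smul' _ _ := rfl

theorem volume_absolutelyContinuous : (volume : Measure ℂ) ≪ bargmannMeasure := by
  refine withDensity_absolutelyContinuous' (by fun_prop) (ae_of_all _ fun z => ?_)
  have : 0 < Real.pi⁻¹ * Real.exp (-‖z‖ ^ 2) := by positivity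
  simpa using this

theorem toL2_injective : Function.Injective toL2 := by
  intro f g h
  have h1 : f.1 =ᵐ[bargmannMeasure] g.1 := (MemLp.toLp_eq_toLp_iff f.2.2 g.2.2).1 h
  have h2 : f.1 =ᵐ[volume] g.1 := volume_absolutelyContinuous.ae_eq h1
  exact Subtype.ext
    ((Continuous.ae_eq_iff_eq volume f.2.1.continuous g.2.1.continuous).1 h2)

instance : NormedAddCommGroup Bargmann :=
  NormedAddCommGroup.induced Bargmann (Lp ℂ 2 bargmannMeasure) toL2 toL2_injective

instance : InnerProductSpace ℂ Bargmann where
  norm_smul_le c f := by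
    change ‖toL2 (c • f)‖ ≤ ‖c‖ * ‖toL2 f‖
    rw [map_smul, norm_smul]
  inner f g := inner ℂ (toL2 f) (toL2 g)
  norm_sq_eq_re_inner f := norm_sq_eq_re_inner (𝕜 := ℂ) (toL2 f)
  conj_inner_symm f g := inner_conj_symm (toL2 f) (toL2 g)
  add_left f g h := by
    change inner ℂ (toL2 (f + g)) (toL2 h) = _
    rw [map_add, inner_add_left]
  smul_left f g c := by
    change inner ℂ (toL2 (c • f)) (toL2 g) = _
    rw [map_smul, inner_smul_left]

theorem inner_eq_integral (f g : Bargmann) :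
    inner ℂ f g = ∫ z, conj (f z) * g z ∂bargmannMeasure := by
  change inner ℂ (toL2 f) (toL2 g) = _
  rw [L2.inner_def]
  refine integral_congr_ae ?_
  filter_upwards [f.2.2.coeFn_toLp, g.2.2.coeFn_toLp] with z hf hg
  change inner ℂ (f.2.2.toLp f.1 z) (g.2.2.toLp g.1 z) = _
  rw [hf, hg, RCLike.inner_apply, mul_comm]

theorem memLp_pow (n : ℕ) : MemLp (fun z : ℂ => z ^ n) 2 bargmannMeasure := by
  rw [memLp_two_iff_integrable_sq_norm (by fun_prop), bargmannMeasure,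
    integrable_withDensity_iff (by fun_prop) (ae_of_all _ fun z => ENNReal.ofReal_lt_top)]
  have h1 : Integrable (fun z : ℂ => Real.exp (-(1 / 2) * ‖z‖ ^ 2)) := by
    have h := (GaussianFourier.integrable_cexp_neg_mul_sq_norm_add (V := ℂ) (b := 1 / 2)
      (by norm_num) 0 0).norm
    refine h.congr (ae_of_all _ fun z => ?_)
    simp [Complex.norm_exp, ← Complex.ofReal_pow]
  refine (h1.const_mul (n.factorial * 2 ^ n * Real.pi⁻¹)).mono' (by fun_prop)
    (ae_of_all _ fun z => ?_)
  have hp : 0 ≤ Real.pi⁻¹ * Real.exp (-‖z‖ ^ 2) := by positivity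
  rw [ENNReal.toReal_ofReal hp, Real.norm_of_nonneg (by positivity), norm_pow]
  have h2 := Real.pow_div_factorial_le_exp (‖z‖ ^ 2 / 2) (by positivity) n
  rw [div_le_iff₀ (by positivity), div_pow, div_le_iff₀ (by positivity)] at h2
  have h3 : Real.exp (-(1 / 2) * ‖z‖ ^ 2)
      = Real.exp (‖z‖ ^ 2 / 2) * Real.exp (-‖z‖ ^ 2) := by
    rw [← Real.exp_add]; congr 1; ring
  calc (‖z‖ ^ n) ^ 2 * (Real.pi⁻¹ * Real.exp (-‖z‖ ^ 2))
      = (‖z‖ ^ 2) ^ n * (Real.pi⁻¹ * Real.exp (-‖z‖ ^ 2)) := by ring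
    _ ≤ (Real.exp (‖z‖ ^ 2 / 2) * n.factorial * 2 ^ n) *
        (Real.pi⁻¹ * Real.exp (-‖z‖ ^ 2)) := mul_le_mul_of_nonneg_right h2 hp
    _ = _ := by rw [h3]; ring

/-! ### Fock-Bargmann basis, coherent states, squeeze operator -/

/-- The Fock-Bargmann basis vector `Φₙ(z) = zⁿ / √(n!)`. -/
def fock (n : ℕ) : Bargmann :=
  ⟨fun z => z ^ n / (Real.sqrt n.factorial : ℂ),
    by fun_prop, by simpa [div_eq_inv_mul] using
      (memLp_pow n).const_mul ((Real.sqrt n.factorial : ℂ)⁻¹)⟩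

/-- The canonical coherent state `exp (-|w|² / 2) ∑ₙ conj (Φₙ(w)) Φₙ`, the series being taken in
the norm of the Bargmann space. -/
def coherentState (w : ℂ) : Bargmann :=
  (Real.exp (-‖w‖ ^ 2 / 2) : ℂ) • ∑' n : ℕ, conj (fock n w) • fock n

/-- The operator `K₊ = z² / 2` on functions. -/
def Kplus (f : ℂ → ℂ) : ℂ → ℂ := fun z => 1 / 2 * z ^ 2 * f z

/-- The operator `K₋ = ∂² / 2` on functions. -/
def Kminus (f : ℂ → ℂ) : ℂ → ℂ := fun z => 1 / 2 * deriv (deriv f) z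

/-- The graph of the operator `ξ K₊ - conj ξ K₋` in the Bargmann space, with the polynomials as
its domain. -/
def squeezeGenerator (ξ : ℂ) : Set (Bargmann × Bargmann) :=
  {p | (∃ q : ℂ[X], ∀ z, p.1 z = q.eval z) ∧
    ∀ z, p.2 z = ξ * Kplus p.1 z - conj ξ * Kminus p.1 z}

/-- The squeeze operator `S(ξ) = exp (ξ K₊ - conj ξ K₋)`. -/
def squeeze (ξ : ℂ) : Bargmann ≃ₗᵢ[ℂ] Bargmann := unitaryExp (squeezeGenerator ξ)

/-- The squeezed basis vector `S(ξ) Φₙ`. -/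
def squeezedFock (ξ : ℂ) (n : ℕ) : Bargmann := squeeze ξ (fock n)

/-- The squeezed coherent state `S(ξ) η`, where `η` is the coherent state at `w`. -/
def squeezedCoherentState (ξ w : ℂ) : Bargmann := squeeze ξ (coherentState w)

/-- `ζ = (tanh |ξ| / |ξ|) ξ`, which is `0` for `ξ = 0`. -/
def squeezeParam (ξ : ℂ) : ℂ := ((Real.tanh ‖ξ‖ / ‖ξ‖ : ℝ) : ℂ) * ξ

/-- The kernel `S^ξ(z, w̄)`, as a function of `z` and `w`. -/
def squeezeKernel (ξ z w : ℂ) : ℂ :=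
  (((1 - ‖squeezeParam ξ‖ ^ 2) ^ (1 / 4 : ℝ) : ℝ) : ℂ) *
    Complex.exp (1 / 2 * (squeezeParam ξ * z ^ 2 - conj (squeezeParam ξ) * conj w ^ 2)) *
    Complex.exp ((Real.sqrt (1 - ‖squeezeParam ξ‖ ^ 2) : ℂ) * z * conj w)

end Bargmann

end

/-! Everything is tested on the reproducing kernels `k_w(z) = exp (z * conj w)`, which satisfy
`⟪k_w, f⟫ = f w` and therefore span a dense subspace. The Gaussian ansatz `exp (c + q z² + l z)`
turns the evolution equation of `ξ K₊ - conj ξ K₋` with initial value `k_w` into a Riccati system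
for `q`, `l`, `c`. It is solved by `tanh` and `1 / cosh`, with `‖q‖ < 1 / 2` at all times, so the
solution never leaves the Bargmann space. At time 1 it is `S^ξ(z, conj w)`.

An abstract principle turns these explicit curves into the unitary group: if a skew-symmetric
operator has `C¹` solution curves, in the domain of its closure, whose initial values are total,
then its closure generates a unique unitary group, which carries the initial values along the curves
(`IsSkewFlow.isUnitaryExp`, `IsSkewFlow.unique`). The curves replace self-adjointness arguments and
Stone's theorem.

Two facts about the Bargmann space feed this principle. Taylor coefficients are inner products with
the Fock vectors (`inner_fock`), which gives the Hilbert basis, bounded point evaluations and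
completeness. Also, `f` is in the domain of the closure as soon as `z² f` and `f''` are in the space
(`mem_closure_squeezeSubmodule`). The claims then follow from `S k_w = S^ξ(·, conj w)` by unitarity
and continuity. -/

noncomputable section

/-! ### Unitary groups generated by the closure of a skew-symmetric operator -/

section SkewFlow

open Filter Topology

variable {H ι : Type*} [NormedAddCommGroup H] [InnerProductSpace ℂ H]

local notation "⟪" x ", " y "⟫" => inner ℂ x y

/-- A set of pairs is the graph of a skew-symmetric relation. -/
def IsSkewGraph (A : Set (H × H)) : Prop :=
  ∀ p ∈ A, ∀ q ∈ A, ⟪p.1, q.2⟫ = -⟪p.2, q.1⟫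

/-- The identity is closed in each pair separately, so the closure is taken in one variable at a
time. -/
theorem IsSkewGraph.closure {A : Set (H × H)} (hA : IsSkewGraph A) :
    IsSkewGraph (closure A) := by
  have h1 : ∀ p ∈ A, ∀ q ∈ _root_.closure A, ⟪p.1, q.2⟫ = -⟪p.2, q.1⟫ := fun p hp =>
    closure_minimal (hA p hp) (isClosed_eq (by fun_prop) (by fun_prop))
  intro p hp q hq
  exact closure_minimal (s := A) (t := {p : H × H | ⟪p.1, q.2⟫ = -⟪p.2, q.1⟫})
    (fun p hp => h1 p hp q hq) (isClosed_eq (by fun_prop) (by fun_prop)) hp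

/-- A family of `C¹` curves `t ↦ F t i`, total at time `0`, which solve the evolution equation
of the closure of a skew-symmetric operator `A`. -/
structure IsSkewFlow (A : Submodule ℂ (H × H)) (F F' : ℝ → ι → H) : Prop where
  skew : IsSkewGraph (A : Set (H × H))
  hasDerivAt : ∀ t i, HasDerivAt (fun t => F t i) (F' t i) t
  continuous_deriv : ∀ i, Continuous fun t => F' t i
  mem : ∀ t i, (F t i, F' t i) ∈ closure (A : Set (H × H))
  dense : (Submodule.span ℂ (Set.range (F 0))).topologicalClosure = ⊤

/-- The equality case of Cauchy-Schwarz: expanding `‖x - y‖²` gives zero. -/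
theorem eq_of_inner_eq {x y : H} (hxy : ‖x‖ = ‖y‖) (h : ⟪x, y⟫ = ⟪x, x⟫) : x = y := by
  rw [← sub_eq_zero, ← norm_eq_zero, ← sq_eq_zero_iff, @norm_sub_sq ℂ, h, hxy.symm,
    @norm_sq_eq_re_inner ℂ _ _ _ _ x]
  ring

namespace IsSkewFlow

variable {A : Submodule ℂ (H × H)} {F F' : ℝ → ι → H}

theorem continuous (hF : IsSkewFlow A F F') (i : ι) : Continuous fun t => F t i :=
  continuous_iff_continuousAt.2 fun t => (hF.hasDerivAt t i).continuousAt

/-- The `t`-derivative of the left side vanishes by skew-symmetry of the closure. The case `s = 0`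
yields isometry; general `s` yields the group law. -/
theorem inner_add (hF : IsSkewFlow A F F') (s t : ℝ) (i j : ι) :
    ⟪F t i, F (s + t) j⟫ = ⟪F 0 i, F s j⟫ := by
  have h : ∀ t, HasDerivAt (fun t => ⟪F t i, F (s + t) j⟫) 0 t := fun t => by
    have h1 : HasDerivAt (fun t => F (s + t) j) (F' (s + t) j) t :=
      (hF.hasDerivAt (s + t) j).comp_const_add s t
    have h2 := (hF.hasDerivAt t i).inner ℂ h1
    have h3 := hF.skew.closure _ (hF.mem t i) _ (hF.mem (s + t) j)
    simp only at h3
    rwa [h3, neg_add_cancel] at h2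
  simpa using is_const_of_deriv_eq_zero (fun t => (h t).differentiableAt)
    (fun t => (h t).deriv) t 0

theorem inner_self (hF : IsSkewFlow A F F') (t : ℝ) (i j : ι) :
    ⟪F t i, F t j⟫ = ⟪F 0 i, F 0 j⟫ := by simpa using hF.inner_add 0 t i j

theorem inner_linearCombination (hF : IsSkewFlow A F F') (s t : ℝ) (x y : ι →₀ ℂ) :
    ⟪Finsupp.linearCombination ℂ (F t) x, Finsupp.linearCombination ℂ (F (s + t)) y⟫ =
      ⟪Finsupp.linearCombination ℂ (F 0) x, Finsupp.linearCombination ℂ (F s) y⟫ := by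
  simp [Finsupp.linearCombination_apply, Finsupp.sum_inner, Finsupp.inner_sum,
    inner_smul_left, inner_smul_right, hF.inner_add]

theorem norm_linearCombination (hF : IsSkewFlow A F F') (t : ℝ) (x : ι →₀ ℂ) :
    ‖Finsupp.linearCombination ℂ (F t) x‖ = ‖Finsupp.linearCombination ℂ (F 0) x‖ := by
  have h := hF.inner_linearCombination 0 t x x
  rw [zero_add] at h
  rw [@norm_eq_sqrt_re_inner ℂ, @norm_eq_sqrt_re_inner ℂ, h]

theorem denseRange (hF : IsSkewFlow A F F') :
    DenseRange (Finsupp.linearCombination ℂ (F 0)) := by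
  have h := hF.dense
  rw [← Finsupp.range_linearCombination] at h
  have h2 := (Submodule.dense_iff_topologicalClosure_eq_top).2 h
  rwa [LinearMap.coe_range] at h2

/-- A closed condition that is additive and holds on the curves at time zero holds everywhere. -/
theorem mem_of_forall (hF : IsSkewFlow A F F') (S : Submodule ℂ H) (hS : IsClosed (S : Set H))
    (h : ∀ i, F 0 i ∈ S) (x : H) : x ∈ S := by
  have h1 : (Submodule.span ℂ (Set.range (F 0))).topologicalClosure ≤ S :=
    Submodule.topologicalClosure_minimal _ (Submodule.span_le.2 (by rintro _ ⟨i, rfl⟩; exact h i))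
      hS
  rw [hF.dense] at h1
  exact h1 trivial

/-- Uniqueness: both curves solve the equation of the closure, so their inner product is constant in
time. As their norms agree, they coincide by the equality case of Cauchy-Schwarz. -/
theorem apply_of_isUnitaryGroup (hF : IsSkewFlow A F F') {U : ℝ → (H ≃ₗᵢ[ℂ] H)}
    (hU : IsUnitaryGroup U) (hUA : generatorGraph U = closure (A : Set (H × H))) (t : ℝ) (i : ι) :
    U t (F 0 i) = F t i := by
  have h1 : ∀ t, HasDerivAt (fun t => U t (F 0 i)) (U t (F' 0 i)) t := fun t => by
    have h2 : HasDerivAt (fun t => U t (F 0 i)) (F' 0 i) 0 := by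
      have := hF.mem 0 i
      rwa [← hUA] at this
    have h3 : HasDerivAt (fun s => U (s - t) (F 0 i)) (F' 0 i) t :=
      HasDerivAt.comp_sub_const t t (by simpa using h2)
    have h4 := ((U t : H →L[ℂ] H).restrictScalars ℝ).hasFDerivAt
      (x := U (t - t) (F 0 i)) |>.comp_hasDerivAt t h3
    refine h4.congr_of_eventuallyEq (Eventually.of_forall fun s => ?_)
    change U s _ = U t (U (s - t) _)
    rw [← hU.map_add, add_sub_cancel]
  have h5 : ∀ t, (U t (F 0 i), U t (F' 0 i)) ∈ closure (A : Set (H × H)) := fun t => by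
    rw [← hUA]
    change HasDerivAt (fun s => U s (U t (F 0 i))) _ 0
    have := HasDerivAt.comp_add_const 0 t (by simpa using h1 t)
    simpa only [hU.map_add] using this
  have h6 : ∀ t, HasDerivAt (fun t => ⟪U t (F 0 i), F t i⟫) 0 t := fun t => by
    have h7 := (h1 t).inner ℂ (hF.hasDerivAt t i)
    have h8 := hF.skew.closure _ (h5 t) _ (hF.mem t i)
    simp only at h8
    rwa [h8, neg_add_cancel] at h7
  have h9 : ⟪U t (F 0 i), F t i⟫ = ⟪F 0 i, F 0 i⟫ := by
    have := is_const_of_deriv_eq_zero (fun t => (h6 t).differentiableAt)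
      (fun t => (h6 t).deriv) t 0
    simpa only [hU.map_zero] using this
  refine eq_of_inner_eq ?_ ?_
  · rw [LinearIsometryEquiv.norm_map, @norm_eq_sqrt_re_inner ℂ, ← hF.inner_self t,
      ← @norm_eq_sqrt_re_inner ℂ]
  · rw [h9, LinearIsometryEquiv.inner_map_map]

theorem apply_of_isUnitaryExp (hF : IsSkewFlow A F F') {S : H ≃ₗᵢ[ℂ] H}
    (hS : IsUnitaryExp (A : Set (H × H)) S) (i : ι) : S (F 0 i) = F 1 i := by
  obtain ⟨U, hU, hUA, rfl⟩ := hS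
  exact hF.apply_of_isUnitaryGroup hU hUA 1 i

theorem unique (hF : IsSkewFlow A F F') {S T : H ≃ₗᵢ[ℂ] H}
    (hS : IsUnitaryExp (A : Set (H × H)) S) (hT : IsUnitaryExp (A : Set (H × H)) T) : S = T := by
  ext x
  refine hF.denseRange.induction_on (p := fun x => S x = T x) x
    (isClosed_eq S.continuous T.continuous) fun y => ?_
  simp only [Finsupp.linearCombination_apply, Finsupp.sum, map_sum, map_smul,
    hF.apply_of_isUnitaryExp hS, hF.apply_of_isUnitaryExp hT]

/-! ### Construction of the group and identification of its generator -/

variable [CompleteSpace H]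

variable (F) in
/-- The continuous linear map which takes `F 0 i` to `F t i`. -/
def evolve (t : ℝ) : H →L[ℂ] H :=
  (Finsupp.linearCombination ℂ (F t)).extendOfNorm (Finsupp.linearCombination ℂ (F 0))

/-- Equality of norms makes the assignment well defined, although the vectors `F 0 i` may be
linearly dependent. -/
theorem evolve_linearCombination (hF : IsSkewFlow A F F') (t : ℝ) (x : ι →₀ ℂ) :
    evolve F t (Finsupp.linearCombination ℂ (F 0) x) = Finsupp.linearCombination ℂ (F t) x :=
  LinearMap.extendOfNorm_eq hF.denseRange
    ⟨1, fun x => by rw [one_mul, hF.norm_linearCombination]⟩ x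

theorem evolve_apply (hF : IsSkewFlow A F F') (t : ℝ) (i : ι) : evolve F t (F 0 i) = F t i := by
  simpa using hF.evolve_linearCombination t (Finsupp.single i 1)

theorem inner_evolve (hF : IsSkewFlow A F F') (s t : ℝ) (x y : H) :
    ⟪evolve F t x, evolve F (s + t) y⟫ = ⟪x, evolve F s y⟫ := by
  refine hF.denseRange.induction_on₂ (p := fun x y =>
    ⟪evolve F t x, evolve F (s + t) y⟫ = ⟪x, evolve F s y⟫)
    (isClosed_eq (by fun_prop) (by fun_prop)) (fun x y => ?_) x y
  simp only [hF.evolve_linearCombination, hF.inner_linearCombination]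

theorem evolve_zero (hF : IsSkewFlow A F F') (x : H) : evolve F 0 x = x := by
  refine hF.denseRange.induction_on (p := fun x => evolve F 0 x = x) x
    (isClosed_eq (by fun_prop) (by fun_prop)) (fun x => ?_)
  simp only [hF.evolve_linearCombination]

theorem inner_evolve_self (hF : IsSkewFlow A F F') (t : ℝ) (x y : H) :
    ⟪evolve F t x, evolve F t y⟫ = ⟪x, y⟫ := by
  simpa [hF.evolve_zero] using hF.inner_evolve 0 t x y

theorem norm_evolve (hF : IsSkewFlow A F F') (t : ℝ) (x : H) : ‖evolve F t x‖ = ‖x‖ := by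
  rw [@norm_eq_sqrt_re_inner ℂ, @norm_eq_sqrt_re_inner ℂ, hF.inner_evolve_self]

/-- The vectors `F t i` need not be initial values of curves, so the group law cannot be read off on
generators. Instead both sides have norm `‖x‖` and their inner product is `‖x‖²`. -/
theorem evolve_add (hF : IsSkewFlow A F F') (s t : ℝ) (x : H) :
    evolve F (s + t) x = evolve F s (evolve F t x) := by
  refine (eq_of_inner_eq (by simp only [hF.norm_evolve]) ?_).symm
  rw [add_comm s t, hF.inner_evolve, hF.inner_evolve_self, hF.inner_evolve_self, hF.inner_evolve_self]

/-- The unitary group of a skew flow. -/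
def group (hF : IsSkewFlow A F F') (t : ℝ) : H ≃ₗᵢ[ℂ] H where
  toFun := evolve F t
  map_add' := map_add _
  map_smul' := map_smul _
  invFun := evolve F (-t)
  left_inv x := by rw [← hF.evolve_add, neg_add_cancel, hF.evolve_zero]
  right_inv x := by rw [← hF.evolve_add, add_neg_cancel, hF.evolve_zero]
  norm_map' := hF.norm_evolve t

theorem continuous_evolve (hF : IsSkewFlow A F F') (x : H) :
    Continuous fun t => evolve F t x := by
  refine hF.denseRange.induction_on (p := fun x => Continuous fun t => evolve F t x) x ?_ ?_
  -- The maps are isometric, so nearby vectors have uniformly close orbits, and continuity survives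
  -- uniform limits.
  · refine isClosed_of_closure_subset fun x hx => ?_
    rw [Metric.mem_closure_iff] at hx
    refine continuous_of_uniform_approx_of_continuous fun u hu => ?_
    obtain ⟨ε, hε, hu⟩ := Metric.mem_uniformity_dist.1 hu
    obtain ⟨y, hy, hxy⟩ := hx ε hε
    refine ⟨fun t => evolve F t y, hy, fun t => hu ?_⟩
    rwa [dist_eq_norm, ← map_sub, hF.norm_evolve, ← dist_eq_norm]
  · intro x
    simp only [hF.evolve_linearCombination]
    simp only [Finsupp.linearCombination_apply, Finsupp.sum]
    exact continuous_finsetSum _ fun i _ => (hF.continuous i).const_smul (x i)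

theorem isUnitaryGroup (hF : IsSkewFlow A F F') : IsUnitaryGroup hF.group where
  map_zero := hF.evolve_zero
  map_add := hF.evolve_add
  continuous := hF.continuous_evolve

/-- The integrated equation `key` suffices, by the fundamental theorem of calculus. It is checked
weakly against the total family `F 0 i`: there `⟪F 0 i, evolve F s f⟫ = ⟪F (-s) i, f⟫`, whose
derivative is `⟪F (-s) i, g⟫` by skew-symmetry. -/
theorem closure_subset_generatorGraph (hF : IsSkewFlow A F F') :
    closure (A : Set (H × H)) ⊆ generatorGraph hF.group := by
  rintro ⟨f, g⟩ hfg
  have hc := hF.continuous_evolve g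
  have key : ∀ t, evolve F t f = f + ∫ s in (0 : ℝ)..t, evolve F s g := by
    intro t
    refine ext_inner_left ℂ fun v => ?_
    let S : Submodule ℂ H := LinearMap.ker
      (innerSL ℂ (evolve F t f - (f + ∫ s in (0 : ℝ)..t, evolve F s g))).toLinearMap
    have hmem : v ∈ S := by
      refine hF.mem_of_forall S (ContinuousLinearMap.isClosed_ker _) (fun i => ?_) v
      have h1 : ∀ s, HasDerivAt (fun s => ⟪F (-s) i, f⟫) ⟪F (-s) i, g⟫ s := fun s => by
        have h2 : HasDerivAt (fun s => F (-s) i) (-F' (-s) i) s := by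
          simpa [Function.comp_def] using (hF.hasDerivAt (-s) i).scomp s (hasDerivAt_neg s)
        have h3 := h2.inner ℂ (hasDerivAt_const s f)
        have h4 := hF.skew.closure _ (hF.mem (-s) i) _ hfg
        simp only at h4
        simpa [h4] using h3
      have h5 : ∀ s h, ⟪F (-s) i, h⟫ = ⟪F 0 i, evolve F s h⟫ := fun s h => by
        have := hF.inner_evolve s (-s) (F 0 i) h
        rwa [hF.evolve_apply, add_neg_cancel, hF.evolve_zero] at this
      simp only [h5] at h1
      have h6 := intervalIntegral.integral_eq_sub_of_hasDerivAt (a := 0) (b := t)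
        (fun s _ => h1 s) ((by fun_prop : Continuous fun s =>
          ⟪F 0 i, evolve F s g⟫).intervalIntegrable _ _)
      have h7 := (innerSL ℂ (F 0 i)).intervalIntegral_comp_comm (hc.intervalIntegrable
        (μ := volume) 0 t)
      simp only [innerSL_apply_apply] at h7
      rw [h7, hF.evolve_zero] at h6
      change ⟪_, _⟫ = (0 : ℂ)
      rw [← inner_conj_symm, inner_sub_right, inner_add_right, h6]
      simp
    have h8 : ⟪evolve F t f - (f + ∫ s in (0 : ℝ)..t, evolve F s g), v⟫ = 0 := hmem
    rw [← sub_eq_zero, ← inner_sub_right, ← inner_conj_symm, h8, map_zero]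
  have h9 : HasDerivAt (fun t => f + ∫ s in (0 : ℝ)..t, evolve F s g) (evolve F 0 g) 0 :=
    (intervalIntegral.integral_hasDerivAt_right (hc.intervalIntegrable _ _)
      (hc.stronglyMeasurableAtFilter _ _) hc.continuousAt).const_add f
  rw [hF.evolve_zero] at h9
  change HasDerivAt (fun t => evolve F t f) g 0
  exact h9.congr_of_eventuallyEq (Eventually.of_forall key)

/-- For `x = F 0 i` the pair is the integral of `(F s i, F' s i)`, which runs in a closed subspace.
Both components are bounded linear in `x`, so totality gives the rest. -/
theorem integral_mem_closure (hF : IsSkewFlow A F F') (t : ℝ) (x : H) :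
    (∫ s in (0 : ℝ)..t, evolve F s x, evolve F t x - x) ∈ A.topologicalClosure := by
  let J : H →L[ℂ] H := LinearMap.mkContinuous
    { toFun := fun x => ∫ s in (0 : ℝ)..t, evolve F s x
      map_add' := fun x y => by
        simp only [map_add]
        exact intervalIntegral.integral_add ((hF.continuous_evolve x).intervalIntegrable _ _)
          ((hF.continuous_evolve y).intervalIntegrable _ _)
      map_smul' := fun c x => by
        simp only [map_smul]
        exact intervalIntegral.integral_smul c _ } |t| fun x => by
      have := intervalIntegral.norm_integral_le_of_norm_le_const (a := 0) (b := t)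
        (f := fun s => evolve F s x) (C := ‖x‖) fun s _ => (hF.norm_evolve s x).le
      simpa [mul_comm] using this
  let T : H →L[ℂ] H × H := J.prod (evolve F t - ContinuousLinearMap.id ℂ H)
  refine hF.mem_of_forall (A.topologicalClosure.comap T.toLinearMap)
    (A.isClosed_topologicalClosure.preimage T.continuous) (fun i => ?_) x
  change (∫ s in (0 : ℝ)..t, evolve F s (F 0 i), evolve F t (F 0 i) - F 0 i) ∈
    A.topologicalClosure
  simp only [hF.evolve_apply]
  have h1 := hF.continuous i
  have h2 := hF.continuous_deriv i
  rw [← intervalIntegral.integral_eq_sub_of_hasDerivAt (fun s _ => hF.hasDerivAt s i)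
    (h2.intervalIntegrable _ _)]
  have h3 : Continuous fun s => (F s i, F' s i) := h1.prodMk h2
  have h4 : (∫ s in (0 : ℝ)..t, F s i, ∫ s in (0 : ℝ)..t, F' s i) =
      ∫ s in (0 : ℝ)..t, (F s i, F' s i) := by
    have h5 := (ContinuousLinearMap.fst ℂ H H).intervalIntegral_comp_comm
      (h3.intervalIntegrable (μ := volume) 0 t)
    have h6 := (ContinuousLinearMap.snd ℂ H H).intervalIntegral_comp_comm
      (h3.intervalIntegrable (μ := volume) 0 t)
    exact Prod.ext h5 h6
  -- The integral lies in the closed subspace because the quotient map commutes with integration and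
  -- kills the integrand.
  rw [h4, ← Submodule.ker_mkQ A.topologicalClosure, LinearMap.mem_ker]
  have : IsClosed (A.topologicalClosure : Set (H × H)) := A.isClosed_topologicalClosure
  have h7 := A.topologicalClosure.mkQL.intervalIntegral_comp_comm
      (h3.intervalIntegrable (μ := volume) 0 t)
  have h8 : ∀ s, A.topologicalClosure.mkQL (F s i, F' s i) = 0 := fun s => by
    have : (F s i, F' s i) ∈ A.topologicalClosure := hF.mem s i
    rw [← Submodule.ker_mkQ A.topologicalClosure] at this
    exact this
  simp only [h8, intervalIntegral.integral_zero] at h7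
  exact h7.symm

/-- Dividing the pair of `integral_mem_closure` by `t` and letting `t → 0` gives `(f, g)` as a limit
of points of the closed graph. -/
theorem generatorGraph_subset_closure (hF : IsSkewFlow A F F') :
    generatorGraph hF.group ⊆ closure (A : Set (H × H)) := by
  rintro ⟨f, g⟩ hfg
  have h1 : HasDerivAt (fun t => evolve F t f) g 0 := hfg
  have hc := hF.continuous_evolve f
  have h2 : HasDerivAt (fun t => ∫ s in (0 : ℝ)..t, evolve F s f) (evolve F 0 f) 0 :=
    intervalIntegral.integral_hasDerivAt_right (hc.intervalIntegrable _ _)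
      (hc.stronglyMeasurableAtFilter _ _) hc.continuousAt
  rw [hF.evolve_zero] at h2
  have h3 := h2.tendsto_slope_zero.prodMk_nhds h1.tendsto_slope_zero
  refine mem_closure_of_tendsto (s := A.topologicalClosure) h3 (Eventually.of_forall fun t => ?_)
    |> A.isClosed_topologicalClosure.closure_subset
  have h4 := A.topologicalClosure.smul_mem ((t⁻¹ : ℝ) : ℂ) (hF.integral_mem_closure t f)
  have h5 : ∀ x : H, t⁻¹ • x = ((t⁻¹ : ℝ) : ℂ) • x := fun x => (Complex.coe_smul _ _).symm
  simpa only [zero_add, intervalIntegral.integral_same, sub_zero, hF.evolve_zero, h5,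
    Prod.smul_mk, SetLike.mem_coe] using h4

theorem isUnitaryExp (hF : IsSkewFlow A F F') : IsUnitaryExp (A : Set (H × H)) (hF.group 1) :=
  ⟨hF.group, hF.isUnitaryGroup,
    hF.generatorGraph_subset_closure.antisymm hF.closure_subset_generatorGraph, rfl⟩

end IsSkewFlow

end SkewFlow

/-! ### Taylor coefficients as inner products -/

section TaylorCoefficients

open Set Real

theorem polarCoord_symm_eq_circleMap (r θ : ℝ) :
    Complex.polarCoord.symm (r, θ) = circleMap 0 r θ := by
  simp [circleMap, Complex.exp_mul_I]

/-- On the circle `conj z = r² / z`, so this is Cauchy's formula for the `n`-th derivative. -/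
theorem integral_circleMap_conj_pow_mul {f : ℂ → ℂ} (hf : Differentiable ℂ f) (n : ℕ) {r : ℝ}
    (hr : 0 < r) :
    ∫ θ in Ioo (-π) π, conj (circleMap 0 r θ) ^ n * f (circleMap 0 r θ) =
      (2 * π * r ^ (2 * n) / n.factorial : ℝ) * iteratedDeriv n f 0 := by
  have h1 := hf.differentiableOn.circleIntegral_one_div_sub_center_pow_smul (c := 0) hr n
  have h2 : ∀ θ : ℝ, deriv (circleMap 0 r) θ •
      (1 / (circleMap 0 r θ - 0) ^ (n + 1)) • f (circleMap 0 r θ) =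
        (Complex.I / (r : ℂ) ^ (2 * n)) *
          (conj (circleMap 0 r θ) ^ n * f (circleMap 0 r θ)) := fun θ => by
    have h0 : circleMap 0 r θ ≠ 0 := by simpa using hr.ne'
    have h3 : (r : ℂ) ^ 2 = circleMap 0 r θ * conj (circleMap 0 r θ) := by
      rw [Complex.mul_conj, Complex.normSq_eq_norm_sq, norm_circleMap_zero, sq_abs]
      push_cast; rfl
    have h4 : (r : ℂ) ^ (2 * n) = circleMap 0 r θ ^ n * conj (circleMap 0 r θ) ^ n := by
      rw [pow_mul, h3, mul_pow]
    have h5 : conj (circleMap 0 r θ) ≠ 0 := by simpa using h0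
    rw [deriv_circleMap, h4, smul_eq_mul, smul_eq_mul, sub_zero]
    field_simp
    ring
  rw [circleIntegral] at h1
  simp only [h2] at h1
  rw [intervalIntegral.integral_const_mul] at h1
  -- Circle integrals run over `[0, 2π]`, polar coordinates over `(-π, π)`; periodicity reconciles
  -- them.
  have hper : Function.Periodic
      (fun θ => conj (circleMap 0 r θ) ^ n * f (circleMap 0 r θ)) (2 * π) := fun θ => by
    simp only [periodic_circleMap 0 r θ]
  have h6 := hper.intervalIntegral_add_eq (-π) 0
  rw [show -π + 2 * π = π by ring, zero_add] at h6
  rw [← integral_Ioc_eq_integral_Ioo, ← intervalIntegral.integral_of_le (by linarith [pi_pos]), h6]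
  have hr' : (r : ℂ) ^ (2 * n) ≠ 0 := by
    have : (r : ℂ) ≠ 0 := by exact_mod_cast hr.ne'
    exact pow_ne_zero _ this
  rw [smul_eq_mul, div_mul_eq_mul_div, div_eq_iff hr'] at h1
  refine mul_left_cancel₀ Complex.I_ne_zero (h1.trans ?_)
  push_cast
  ring

theorem integral_pow_mul_exp_neg_sq (n : ℕ) :
    ∫ r in Ioi (0 : ℝ), r ^ (2 * n + 1) * exp (-r ^ 2) = n.factorial / 2 := by
  have h := integral_rpow_mul_exp_neg_rpow (p := 2) (q := 2 * n + 1) two_pos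
    (by have := n.cast_nonneg (α := ℝ); linarith)
  rw [show ((2 * n + 1 : ℝ) + 1) / 2 = n + 1 by ring, Real.Gamma_nat_eq_factorial] at h
  rw [show (n.factorial : ℝ) / 2 = 1 / 2 * n.factorial by ring, ← h]
  refine setIntegral_congr_fun measurableSet_Ioi fun r _ => ?_
  have h2 : r ^ (2 * n + 1 : ℝ) = r ^ (2 * n + 1) := by
    rw [← Real.rpow_natCast]; push_cast; rfl
  simp only [h2, Real.rpow_two]

theorem Complex.integrableOn_comp_polarCoord_symm {E : Type*} [NormedAddCommGroup E]
    [NormedSpace ℝ E] {g : ℂ → E} (hg : Integrable g) (hc : Continuous g) :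
    IntegrableOn (fun p : ℝ × ℝ => p.1 • g (Complex.polarCoord.symm p)) polarCoord.target := by
  have hcont : Continuous fun p : ℝ × ℝ => p.1 • g (Complex.polarCoord.symm p) := by
    simp only [Complex.polarCoord_symm_apply]
    fun_prop
  refine ⟨hcont.aestronglyMeasurable, ?_⟩
  rw [HasFiniteIntegral]
  refine lt_of_eq_of_lt ?_ hg.2
  rw [← Complex.lintegral_comp_polarCoord_symm]
  refine setLIntegral_congr_fun polarCoord.open_target.measurableSet fun p hp => ?_
  simp only [enorm_smul, smul_eq_mul]
  rw [Real.enorm_eq_ofReal (le_of_lt hp.1)]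

theorem integral_bargmannMeasure (f : ℂ → ℂ) :
    ∫ z, f z ∂bargmannMeasure = ∫ z, (π⁻¹ * exp (-‖z‖ ^ 2)) • f z := by
  rw [bargmannMeasure, integral_withDensity_eq_integral_toReal_smul (by fun_prop)
    (ae_of_all _ fun z => ENNReal.ofReal_lt_top)]
  refine integral_congr_ae (ae_of_all _ fun z => ?_)
  simp only
  rw [ENNReal.toReal_ofReal (by positivity)]

theorem integrable_bargmannMeasure_iff {f : ℂ → ℂ} :
    Integrable f bargmannMeasure ↔ Integrable fun z => (π⁻¹ * exp (-‖z‖ ^ 2)) • f z := by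
  rw [bargmannMeasure, integrable_withDensity_iff_integrable_smul₀' (by fun_prop)
    (ae_of_all _ fun z => ENNReal.ofReal_lt_top)]
  refine integrable_congr (ae_of_all _ fun z => ?_)
  simp only
  rw [ENNReal.toReal_ofReal (by positivity)]

/-- In polar coordinates the angular integral is Cauchy's formula; the remaining radial integral `n!
/ 2` cancels the factor `2 / n!`. -/
theorem integral_conj_pow_mul {f : ℂ → ℂ} (hf : Differentiable ℂ f) (n : ℕ)
    (hi : Integrable (fun z => conj z ^ n * f z) bargmannMeasure) :
    ∫ z, conj z ^ n * f z ∂bargmannMeasure = iteratedDeriv n f 0 := by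
  have hfc := hf.continuous
  have hc : Continuous fun z : ℂ => (π⁻¹ * exp (-‖z‖ ^ 2)) • (conj z ^ n * f z) :=
    Continuous.smul (f := fun z : ℂ => π⁻¹ * exp (-‖z‖ ^ 2)) (by fun_prop)
      (((Complex.continuous_conj).pow n).mul hfc)
  have hI := Complex.integrableOn_comp_polarCoord_symm (integrable_bargmannMeasure_iff.1 hi) hc
  rw [integral_bargmannMeasure, ← Complex.integral_comp_polarCoord_symm]
  rw [polarCoord_target] at hI ⊢
  rw [Measure.volume_eq_prod] at hI ⊢
  rw [setIntegral_prod _ hI]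
  have h1 : ∀ r ∈ Ioi (0 : ℝ), (∫ θ in Ioo (-π) π, r • (π⁻¹ * exp (-‖Complex.polarCoord.symm
      (r, θ)‖ ^ 2)) • (conj (Complex.polarCoord.symm (r, θ)) ^ n *
        f (Complex.polarCoord.symm (r, θ)))) =
      ((2 / n.factorial : ℝ) * iteratedDeriv n f 0) * (r ^ (2 * n + 1) * exp (-r ^ 2) : ℝ) := by
    intro r hr
    simp only [polarCoord_symm_eq_circleMap, norm_circleMap_zero, sq_abs]
    rw [integral_smul, integral_smul, integral_circleMap_conj_pow_mul hf n hr]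
    simp only [Complex.real_smul]
    have : (π : ℂ) ≠ 0 := by exact_mod_cast pi_ne_zero
    push_cast
    field_simp
    ring
  rw [setIntegral_congr_fun measurableSet_Ioi h1, integral_const_mul, integral_complex_ofReal,
    integral_pow_mul_exp_neg_sq]
  have : (n.factorial : ℂ) ≠ 0 := by exact_mod_cast n.factorial_ne_zero
  push_cast
  field_simp

end TaylorCoefficients

/-! ### Fock basis, point evaluations and completeness -/

namespace Bargmann

theorem differentiable (f : Bargmann) : Differentiable ℂ f := f.2.1

theorem memLp (f : Bargmann) : MemLp f 2 bargmannMeasure := f.2.2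

/-- The element of the Bargmann space given by a function. -/
def mk (f : ℂ → ℂ) (hd : Differentiable ℂ f) (hL : MemLp f 2 bargmannMeasure) : Bargmann :=
  ⟨f, hd, hL⟩

theorem mk_apply {f : ℂ → ℂ} (hd : Differentiable ℂ f) (hL : MemLp f 2 bargmannMeasure) (z : ℂ) :
    mk f hd hL z = f z := rfl

theorem add_apply (f g : Bargmann) (z : ℂ) : (f + g) z = f z + g z := rfl

theorem sub_apply (f g : Bargmann) (z : ℂ) : (f - g) z = f z - g z := rfl

theorem smul_apply (c : ℂ) (f : Bargmann) (z : ℂ) : (c • f) z = c * f z := rfl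

theorem integrable_conj_mul (f g : Bargmann) :
    Integrable (fun z => conj (f z) * g z) bargmannMeasure := by
  have h := f.memLp.star.integrable_mul g.memLp
  exact h

theorem sqrt_factorial_ne_zero (n : ℕ) : (Real.sqrt n.factorial : ℂ) ≠ 0 := by
  have : Real.sqrt n.factorial ≠ 0 := by positivity
  exact_mod_cast this

theorem sqrt_factorial_mul_self (n : ℕ) :
    (Real.sqrt n.factorial : ℂ) * (Real.sqrt n.factorial : ℂ) = n.factorial := by
  rw [← Complex.ofReal_mul, Real.mul_self_sqrt (by positivity), Complex.ofReal_natCast]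

theorem fock_apply (n : ℕ) (z : ℂ) : fock n z = z ^ n / (Real.sqrt n.factorial : ℂ) := rfl

theorem inner_fock (n : ℕ) (f : Bargmann) :
    inner ℂ (fock n) f = iteratedDeriv n f 0 / (Real.sqrt n.factorial : ℂ) := by
  have hc := sqrt_factorial_ne_zero n
  have h1 : ∀ z, conj (fock n z) * f z =
      (Real.sqrt n.factorial : ℂ)⁻¹ * (conj z ^ n * f z) := fun z => by
    change conj (z ^ n / (Real.sqrt n.factorial : ℂ)) * f z = _
    rw [map_div₀, map_pow, Complex.conj_ofReal]
    ring
  have h2 := integrable_conj_mul (fock n) f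
  simp only [h1] at h2
  rw [integrable_const_mul_iff (isUnit_iff_ne_zero.2 (inv_ne_zero hc))] at h2
  rw [inner_eq_integral]
  simp only [h1]
  rw [integral_const_mul, integral_conj_pow_mul f.differentiable n h2]
  ring

theorem orthonormal_fock : Orthonormal ℂ fock := by
  rw [orthonormal_iff_ite]
  intro m n
  rw [inner_fock]
  have h : (fock n : ℂ → ℂ) = fun z : ℂ => z ^ n / (Real.sqrt n.factorial : ℂ) := rfl
  rw [h, iteratedDeriv_div_const, iteratedDeriv_fun_pow_zero]
  split_ifs with hmn
  · subst hmn
    rw [div_div, sqrt_factorial_mul_self, div_self (by exact_mod_cast m.factorial_ne_zero)]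
  · simp

/-- The Taylor series, in terms of the Fock basis. -/
theorem hasSum_inner_fock_mul (f : Bargmann) (z : ℂ) :
    HasSum (fun n => inner ℂ (fock n) f * fock n z) (f z) := by
  have h := Complex.hasSum_taylorSeries_of_entire f.differentiable 0 z
  refine h.congr_fun fun n => ?_
  rw [inner_fock, fock_apply, div_mul_div_comm, sqrt_factorial_mul_self]
  simp only [sub_zero, smul_eq_mul]
  ring

theorem eq_zero_of_inner_fock {f : Bargmann} (h : ∀ n, inner ℂ (fock n) f = 0) : f = 0 := by
  ext z
  have h1 := hasSum_inner_fock_mul f z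
  simp only [h, zero_mul] at h1
  exact h1.unique hasSum_zero

theorem summable_norm_fock (z : ℂ) : Summable fun n => ‖fock n z‖ ^ 2 := by
  refine (Real.summable_pow_div_factorial (‖z‖ ^ 2)).congr fun n => ?_
  rw [fock_apply, norm_div, norm_pow, div_pow, Complex.norm_real,
    Real.norm_of_nonneg (Real.sqrt_nonneg _), Real.sq_sqrt (by positivity)]
  ring

theorem norm_fock_apply_le {r : ℝ} {z : ℂ} (hz : ‖z‖ ≤ r) (n : ℕ) :
    ‖fock n z‖ ≤ ‖fock n (r : ℂ)‖ := by
  have hr : 0 ≤ r := (norm_nonneg z).trans hz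
  rw [fock_apply, fock_apply, norm_div, norm_div, norm_pow, norm_pow, Complex.norm_real r,
    Real.norm_of_nonneg hr]
  gcongr

theorem summable_norm_fock_one (r : ℝ) : Summable fun n => ‖fock n (r : ℂ)‖ := by
  refine .of_nonneg_of_le (fun n => norm_nonneg _) (fun n => ?_)
    ((summable_norm_fock ((2 * r : ℝ) : ℂ)).add
      (summable_geometric_of_lt_one (r := 1 / 4) (by norm_num) (by norm_num)))
  -- Doubling the radius gains a geometric factor; then `a b ≤ a² + b²` reduces to two summable
  -- series.
  have h : ‖fock n (r : ℂ)‖ = ‖fock n ((2 * r : ℝ) : ℂ)‖ * (1 / 2) ^ n := by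
    rw [fock_apply, fock_apply]
    push_cast
    rw [mul_pow, norm_div, norm_div, norm_mul, norm_pow 2 n, Complex.norm_ofNat, one_div, inv_pow]
    field_simp
  have h2 : ((1 : ℝ) / 4) ^ n = ((1 / 2) ^ n) ^ 2 := by rw [← pow_mul, mul_comm, pow_mul]; norm_num
  rw [h, h2]
  nlinarith [sq_nonneg (‖fock n ((2 * r : ℝ) : ℂ)‖ - (1 / 2) ^ n), sq_nonneg ((1 / 2 : ℝ) ^ n),
    sq_nonneg ‖fock n ((2 * r : ℝ) : ℂ)‖]

/-- Point evaluations are bounded, locally uniformly. -/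
theorem norm_apply_le (f : Bargmann) {r : ℝ} {z : ℂ} (hz : ‖z‖ ≤ r) :
    ‖f z‖ ≤ (∑' n, ‖fock n (r : ℂ)‖) * ‖f‖ := by
  rw [← (hasSum_inner_fock_mul f z).tsum_eq, ← tsum_mul_right]
  refine tsum_of_norm_bounded (((summable_norm_fock_one r).mul_right ‖f‖).hasSum) fun n => ?_
  rw [norm_mul, mul_comm]
  refine mul_le_mul (norm_fock_apply_le hz n) ?_ (norm_nonneg _) (norm_nonneg _)
  have := norm_inner_le_norm (𝕜 := ℂ) (fock n) f
  rwa [orthonormal_fock.1 n, one_mul] at this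

theorem isometry_toL2 : Isometry toL2 := AddMonoidHomClass.isometry_of_norm toL2 fun _ => rfl

-- A Cauchy sequence converges locally uniformly, by the bound on point evaluations, to an entire
-- function, and in `L²` to some `g`. An almost everywhere convergent subsequence identifies the two
-- limits.
open Filter Topology in
instance : CompleteSpace Bargmann := by
  refine Metric.complete_of_cauchySeq_tendsto fun u hu => ?_
  obtain ⟨g, hg⟩ := cauchySeq_tendsto_of_complete (isometry_toL2.uniformContinuous.comp_cauchySeq hu)
  have hbound : ∀ r : ℝ, UniformCauchySeqOn (fun n z => u n z) atTop (Metric.closedBall 0 r) := by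
    intro r
    rw [Metric.uniformCauchySeqOn_iff]
    intro ε hε
    set M := ∑' n, ‖fock n (r : ℂ)‖
    have hM : 0 ≤ M := tsum_nonneg fun n => norm_nonneg _
    obtain ⟨N, hN⟩ := Metric.cauchySeq_iff.1 hu (ε / (M + 1)) (by positivity)
    refine ⟨N, fun m hm n hn z hz => ?_⟩
    rw [dist_eq_norm, ← sub_apply]
    have h1 := norm_apply_le (u m - u n) (mem_closedBall_zero_iff.1 hz)
    have h2 := hN m hm n hn
    rw [dist_eq_norm, lt_div_iff₀ (by positivity)] at h2
    calc _ ≤ M * ‖u m - u n‖ := h1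
      _ ≤ ‖u m - u n‖ * (M + 1) := by nlinarith [norm_nonneg (u m - u n)]
      _ < ε := h2
  have hlim : ∀ z, ∃ w, Tendsto (fun n => u n z) atTop (𝓝 w) := fun z =>
    cauchySeq_tendsto_of_complete ((hbound ‖z‖).cauchySeq (by simp))
  choose F hF using hlim
  have hloc : TendstoLocallyUniformlyOn (fun n z => u n z) F atTop Set.univ := by
    rw [tendstoLocallyUniformlyOn_iff_forall_isCompact isOpen_univ]
    intro K _ hK
    obtain ⟨r, hr⟩ := hK.isBounded.subset_closedBall 0
    exact ((hbound r).tendstoUniformlyOn_of_tendsto fun z _ => hF z).mono hr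
  have hFd : Differentiable ℂ F := by
    rw [← differentiableOn_univ]
    exact hloc.differentiableOn (Eventually.of_forall fun n => (u n).differentiable.differentiableOn)
      isOpen_univ
  have hae : F =ᵐ[bargmannMeasure] g := by
    obtain ⟨ns, hns, h1⟩ := (tendstoInMeasure_of_tendsto_Lp hg).exists_seq_tendsto_ae
    have h2 : ∀ᵐ z ∂bargmannMeasure, ∀ n, toL2 (u n) z = u n z :=
      ae_all_iff.2 fun n => (u n).memLp.coeFn_toLp
    filter_upwards [h1, h2] with z hz1 hz2
    simp only [Function.comp_apply, hz2] at hz1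
    exact tendsto_nhds_unique ((hF z).comp hns.tendsto_atTop) hz1
  have hFL : MemLp F 2 bargmannMeasure := (memLp_congr_ae hae).2 (Lp.memLp g)
  refine ⟨mk F hFd hFL, ?_⟩
  rw [isometry_toL2.isEmbedding.tendsto_nhds_iff]
  have h3 : toL2 (mk F hFd hFL) = g := Lp.ext (hFL.coeFn_toLp.trans hae)
  rwa [h3]

/-- The Fock basis. -/
def fockBasis : HilbertBasis ℕ ℂ Bargmann :=
  HilbertBasis.mkOfOrthogonalEqBot orthonormal_fock <| by
    rw [Submodule.eq_bot_iff]
    intro f hf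
    refine eq_zero_of_inner_fock fun n => ?_
    exact (Submodule.mem_orthogonal _ _).1 hf _ (Submodule.subset_span ⟨n, rfl⟩)

theorem coe_fockBasis : (fockBasis : ℕ → Bargmann) = fock :=
  HilbertBasis.coe_mkOfOrthogonalEqBot _ _

theorem hasSum_inner_fock_smul (f : Bargmann) :
    HasSum (fun n => (inner ℂ (fock n) f : ℂ) • fock n) f := by
  simpa [coe_fockBasis, HilbertBasis.repr_apply_apply] using fockBasis.hasSum_repr f

/-! ### The reproducing kernel -/

theorem summable_kernel (w : ℂ) : Summable fun n : ℕ => conj (fock n w) • fock n := by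
  have h := orthonormal_fock.orthogonalFamily.summable_iff_norm_sq_summable
    (fun n => conj (fock n w))
  simp only [LinearIsometry.toSpanSingleton_apply, RCLike.norm_conj] at h
  exact h.2 (summable_norm_fock w)

/-- The reproducing kernel `z ↦ exp (z * conj w)`. -/
def kernel (w : ℂ) : Bargmann := ∑' n : ℕ, conj (fock n w) • fock n

theorem hasSum_kernel (w : ℂ) : HasSum (fun n : ℕ => conj (fock n w) • fock n) (kernel w) :=
  (summable_kernel w).hasSum

theorem inner_kernel (w : ℂ) (f : Bargmann) : inner ℂ (kernel w) f = f w := by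
  have h := (hasSum_kernel w).map (innerSL ℂ f) (innerSL ℂ f).continuous
  have h2 := h.map (starRingEnd ℂ) Complex.continuous_conj
  refine HasSum.unique ?_ (hasSum_inner_fock_mul f w)
  convert h2 using 1
  · ext n
    simp [inner_smul_right, mul_comm]
  · simp

theorem ext_inner_kernel {f g : Bargmann}
    (h : ∀ w, inner ℂ (kernel w) f = inner ℂ (kernel w) g) : f = g := by
  ext z
  rw [← inner_kernel, h, inner_kernel]

/-- A function orthogonal to all kernels vanishes at every point, by the reproducing property. -/
theorem dense_span_kernel : (Submodule.span ℂ (Set.range kernel)).topologicalClosure = ⊤ := by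
  rw [Submodule.topologicalClosure_eq_top_iff, Submodule.eq_bot_iff]
  intro f hf
  ext w
  rw [← inner_kernel]
  exact (Submodule.mem_orthogonal _ _).1 hf _ (Submodule.subset_span ⟨w, rfl⟩)

theorem kernel_apply (w z : ℂ) : kernel w z = Complex.exp (z * conj w) := by
  have h := (hasSum_kernel w).map (innerSL ℂ (kernel z)) (innerSL ℂ (kernel z)).continuous
  simp only [innerSL_apply_apply, inner_kernel] at h
  refine h.unique ?_
  have h2 := NormedSpace.expSeries_div_hasSum_exp (z * conj w)
  rw [← Complex.exp_eq_exp_ℂ] at h2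
  refine h2.congr_fun fun n => ?_
  rw [Function.comp_apply, innerSL_apply_apply, inner_smul_right, inner_kernel]
  rw [fock_apply, fock_apply, map_div₀, map_pow, Complex.conj_ofReal, div_mul_div_comm,
    sqrt_factorial_mul_self, mul_pow, mul_comm]

end Bargmann

namespace Bargmann

/-! ### Multiplication by `z²` and the second derivative in the Fock basis -/

theorem iteratedDeriv_succ_id_mul {f : ℂ → ℂ} (hf : Differentiable ℂ f) (n : ℕ) :
    iteratedDeriv (n + 1) (fun z => z * f z) =
      fun z => z * iteratedDeriv (n + 1) f z + (n + 1) * iteratedDeriv n f z := by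
  have hd : ∀ n z, HasDerivAt (iteratedDeriv n f) (iteratedDeriv (n + 1) f z) z := fun n z => by
    rw [iteratedDeriv_succ]
    exact ((hf.contDiff (n := ⊤)).differentiable_iteratedDeriv n
      (by exact_mod_cast WithTop.coe_lt_top _) z).hasDerivAt
  induction n with
  | zero =>
    ext z
    have h := (hasDerivAt_id z).mul (hd 0 z)
    simp only [iteratedDeriv_zero] at h
    rw [iteratedDeriv_one]
    refine h.deriv.trans ?_
    simp
    ring
  | succ n ih =>
    ext z
    rw [iteratedDeriv_succ, ih]
    refine (((hasDerivAt_id z).mul (hd (n + 1) z)).add ((hd n z).const_mul _)).deriv.trans ?_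
    simp
    ring

/-- The ladder coefficient `√((n + 1) (n + 2))`. -/
def ladder (n : ℕ) : ℂ := (Real.sqrt (n + 2).factorial : ℂ) / (Real.sqrt n.factorial : ℂ)

theorem conj_ladder (n : ℕ) : conj (ladder n) = ladder n := by simp [ladder]

theorem ladder_eq (n : ℕ) :
    ladder n = (n + 2) * (n + 1) * (Real.sqrt n.factorial : ℂ) /
      (Real.sqrt (n + 2).factorial : ℂ) := by
  rw [ladder, div_eq_div_iff (sqrt_factorial_ne_zero _) (sqrt_factorial_ne_zero _), mul_assoc,
    sqrt_factorial_mul_self, sqrt_factorial_mul_self, Nat.factorial_succ, Nat.factorial_succ]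
  push_cast
  ring

theorem inner_fock_of_eq_deriv_deriv {g h : Bargmann} (hg : ∀ z, h z = deriv (deriv g) z) (n : ℕ) :
    inner ℂ (fock n) h = ladder n * inner ℂ (fock (n + 2)) g := by
  have h1 : (h : ℂ → ℂ) = deriv (deriv g) := funext hg
  rw [inner_fock, inner_fock, h1, iteratedDeriv_succ', iteratedDeriv_succ', ladder]
  have h2 := sqrt_factorial_ne_zero n
  have h3 := sqrt_factorial_ne_zero (n + 2)
  field_simp

theorem inner_fock_of_eq_sq_mul {f h : Bargmann} (hf : ∀ z, h z = z ^ 2 * f z) (n : ℕ) :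
    inner ℂ (fock (n + 2)) h = ladder n * inner ℂ (fock n) f := by
  have h1 : (h : ℂ → ℂ) = fun z => z * (z * f z) := by
    ext z
    rw [hf]
    ring
  have hd : Differentiable ℂ fun z => z * f z := differentiable_id.mul f.differentiable
  rw [inner_fock, inner_fock, h1, iteratedDeriv_succ_id_mul hd]
  simp only [zero_mul, zero_add]
  rw [iteratedDeriv_succ_id_mul f.differentiable n, ladder_eq]
  have h2 := sqrt_factorial_ne_zero n
  have h3 := sqrt_factorial_ne_zero (n + 2)
  push_cast
  field_simp
  ring

theorem inner_fock_of_eq_sq_mul_of_lt {f h : Bargmann} (hf : ∀ z, h z = z ^ 2 * f z) {n : ℕ}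
    (hn : n < 2) : inner ℂ (fock n) h = 0 := by
  have h1 : (h : ℂ → ℂ) = fun z => z * (z * f z) := by
    ext z
    rw [hf]
    ring
  have hd : Differentiable ℂ fun z => z * f z := differentiable_id.mul f.differentiable
  rw [inner_fock, h1]
  interval_cases n
  · simp
  · rw [iteratedDeriv_succ_id_mul hd]
    simp

theorem hasSum_inner_mul_inner (f g : Bargmann) :
    HasSum (fun n => inner ℂ f (fock n) * inner ℂ (fock n) g) (inner ℂ f g) := by
  simpa only [coe_fockBasis] using fockBasis.hasSum_inner_mul_inner f g

/-- Multiplication by `z²` and the second derivative are adjoint to each other. -/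
theorem inner_sq_mul_eq_inner_deriv_deriv {f f₂ g g₂ : Bargmann} (hf : ∀ z, f₂ z = z ^ 2 * f z)
    (hg : ∀ z, g₂ z = deriv (deriv g) z) : inner ℂ f₂ g = inner ℂ f g₂ := by
  -- The coefficients of `z² f` at `0` and `1` vanish; after the shift by two, Parseval's series
  -- agree term by term.
  have h1 := (hasSum_nat_add_iff' 2).2 (hasSum_inner_mul_inner f₂ g)
  have h2 : ∑ i ∈ Finset.range 2, inner ℂ f₂ (fock i) * inner ℂ (fock i) g = 0 :=
    Finset.sum_eq_zero fun i hi => by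
      rw [← inner_conj_symm, inner_fock_of_eq_sq_mul_of_lt hf (Finset.mem_range.1 hi), map_zero,
        zero_mul]
  rw [h2, sub_zero] at h1
  refine h1.unique ((hasSum_inner_mul_inner f g₂).congr_fun fun n => ?_)
  rw [← inner_conj_symm f₂, inner_fock_of_eq_sq_mul hf, inner_fock_of_eq_deriv_deriv hg, map_mul,
    conj_ladder, inner_conj_symm]
  ring

theorem inner_squeeze_skew (ξ : ℂ) {f f₂ f₃ g g₂ g₃ : Bargmann}
    (hf₂ : ∀ z, f₂ z = z ^ 2 * f z) (hf₃ : ∀ z, f₃ z = deriv (deriv f) z)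
    (hg₂ : ∀ z, g₂ z = z ^ 2 * g z) (hg₃ : ∀ z, g₃ z = deriv (deriv g) z) :
    inner ℂ f ((ξ / 2) • g₂ - (conj ξ / 2) • g₃) =
      -inner ℂ ((ξ / 2) • f₂ - (conj ξ / 2) • f₃) g := by
  have h1 : inner ℂ f g₂ = inner ℂ f₃ g := by
    rw [← inner_conj_symm, inner_sq_mul_eq_inner_deriv_deriv hg₂ hf₃, inner_conj_symm]
  rw [inner_sub_right, inner_sub_left, inner_smul_left, inner_smul_left, inner_smul_right,
    inner_smul_right, h1, inner_sq_mul_eq_inner_deriv_deriv hf₂ hg₃]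
  simp [Complex.conj_ofNat]

/-! ### The generator on polynomials -/

theorem memLp_eval (q : ℂ[X]) : MemLp (fun z => q.eval z) 2 bargmannMeasure := by
  simp only [Polynomial.eval_eq_sum, Polynomial.sum]
  exact memLp_finsetSum _ fun n _ => (memLp_pow n).const_mul _

/-- Polynomials as elements of the Bargmann space. -/
def ofPolynomial : ℂ[X] →ₗ[ℂ] Bargmann where
  toFun q := mk (fun z => q.eval z) q.differentiable (memLp_eval q)
  map_add' p q := by
    ext z
    exact Polynomial.eval_add
  map_smul' c q := by
    ext z
    change (c • q).eval z = c * q.eval z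
    simp

theorem ofPolynomial_apply (q : ℂ[X]) (z : ℂ) : ofPolynomial q z = q.eval z := rfl

theorem deriv_deriv_ofPolynomial (q : ℂ[X]) (z : ℂ) :
    ofPolynomial (derivative (derivative q)) z = deriv (deriv (ofPolynomial q)) z := by
  have h : (ofPolynomial q : ℂ → ℂ) = fun z => q.eval z := rfl
  rw [h, show deriv (fun z => q.eval z) = fun z => (derivative q).eval z from
    funext fun z => q.deriv, Polynomial.deriv]
  rfl

/-- The operator `ξ z² / 2 - conj ξ ∂² / 2`, as a map from the polynomials to the Bargmann
space. -/
def squeezeOnPolynomial (ξ : ℂ) : ℂ[X] →ₗ[ℂ] Bargmann :=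
  (ξ / 2) • ofPolynomial ∘ₗ LinearMap.mulLeft ℂ (X ^ 2) -
    (conj ξ / 2) • ofPolynomial ∘ₗ derivative ∘ₗ derivative

theorem squeezeOnPolynomial_eq (ξ : ℂ) (q : ℂ[X]) :
    squeezeOnPolynomial ξ q = (ξ / 2) • ofPolynomial (X ^ 2 * q) -
      (conj ξ / 2) • ofPolynomial (derivative (derivative q)) := rfl

theorem ofPolynomial_sq_mul (q : ℂ[X]) (z : ℂ) :
    ofPolynomial (X ^ 2 * q) z = z ^ 2 * ofPolynomial q z := by
  simp [ofPolynomial_apply]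

/-- The graph of `ξ K₊ - conj ξ K₋` on the polynomials, as a subspace. -/
def squeezeSubmodule (ξ : ℂ) : Submodule ℂ (Bargmann × Bargmann) :=
  LinearMap.range (ofPolynomial.prod (squeezeOnPolynomial ξ))

theorem squeezeGenerator_apply {f f₂ f₃ : Bargmann} (ξ : ℂ) (hf₂ : ∀ z, f₂ z = z ^ 2 * f z)
    (hf₃ : ∀ z, f₃ z = deriv (deriv f) z) (z : ℂ) :
    ((ξ / 2) • f₂ - (conj ξ / 2) • f₃) z = ξ * Kplus f z - conj ξ * Kminus f z := by
  rw [sub_apply, smul_apply, smul_apply, hf₂, hf₃, Kplus, Kminus]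
  ring

theorem coe_squeezeSubmodule (ξ : ℂ) :
    (squeezeSubmodule ξ : Set (Bargmann × Bargmann)) = squeezeGenerator ξ := by
  ext ⟨f, g⟩
  constructor
  · rintro ⟨q, hq⟩
    obtain ⟨rfl, rfl⟩ := Prod.ext_iff.1 hq
    exact ⟨⟨q, fun z => rfl⟩, fun z => squeezeGenerator_apply ξ (ofPolynomial_sq_mul q)
      (deriv_deriv_ofPolynomial q) z⟩
  · rintro ⟨⟨q, hq⟩, hg⟩
    have h1 : ofPolynomial q = f := ext fun z => (hq z).symm
    refine ⟨q, Prod.ext h1 (ext fun z => ?_)⟩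
    refine (squeezeGenerator_apply ξ (ofPolynomial_sq_mul q)
      (deriv_deriv_ofPolynomial q) z).trans ?_
    rw [h1]
    exact (hg z).symm

theorem isSkewGraph_squeezeSubmodule (ξ : ℂ) :
    IsSkewGraph (squeezeSubmodule ξ : Set (Bargmann × Bargmann)) := by
  rintro _ ⟨p, rfl⟩ _ ⟨q, rfl⟩
  exact inner_squeeze_skew ξ (ofPolynomial_sq_mul p) (deriv_deriv_ofPolynomial p)
    (ofPolynomial_sq_mul q) (deriv_deriv_ofPolynomial q)

/-- The polynomial `zⁿ / √(n!)`. -/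
def fockPolynomial (n : ℕ) : ℂ[X] := C (Real.sqrt n.factorial : ℂ)⁻¹ * X ^ n

theorem ofPolynomial_fockPolynomial (n : ℕ) : ofPolynomial (fockPolynomial n) = fock n := by
  ext z
  rw [ofPolynomial_apply, fockPolynomial, fock_apply]
  simp [div_eq_inv_mul]

theorem ofPolynomial_sq_mul_fockPolynomial (n : ℕ) :
    ofPolynomial (X ^ 2 * fockPolynomial n) = ladder n • fock (n + 2) := by
  ext z
  have h2 := sqrt_factorial_ne_zero n
  have h3 := sqrt_factorial_ne_zero (n + 2)
  rw [ofPolynomial_sq_mul, ofPolynomial_fockPolynomial, smul_apply, fock_apply, fock_apply, ladder]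
  field_simp
  ring

theorem ofPolynomial_derivative_fockPolynomial (n : ℕ) :
    ofPolynomial (derivative (derivative (fockPolynomial (n + 2)))) = ladder n • fock n := by
  ext z
  have h2 := sqrt_factorial_ne_zero n
  have h3 := sqrt_factorial_ne_zero (n + 2)
  rw [ofPolynomial_apply, fockPolynomial, smul_apply, fock_apply, ladder_eq]
  simp
  field_simp
  ring

theorem derivative_fockPolynomial_of_lt {n : ℕ} (hn : n < 2) :
    derivative (derivative (fockPolynomial n)) = 0 := by
  interval_cases n <;> simp [fockPolynomial]

/-- The Fock partial sums of `f` are polynomials, and `z²` and `∂²` map them, up to a shift of index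
by two, to the Fock partial sums of `f₂` and `f₃`. Hence they converge in the graph norm. -/
theorem mem_closure_squeezeSubmodule (ξ : ℂ) {f f₂ f₃ : Bargmann}
    (hf₂ : ∀ z, f₂ z = z ^ 2 * f z) (hf₃ : ∀ z, f₃ z = deriv (deriv f) z) :
    (f, (ξ / 2) • f₂ - (conj ξ / 2) • f₃) ∈
      closure (squeezeSubmodule ξ : Set (Bargmann × Bargmann)) := by
  let c : ℕ → ℂ := fun n => inner ℂ (fock n) f
  have h1 : HasSum (fun n => c n • ofPolynomial (fockPolynomial n)) f := by
    simp only [ofPolynomial_fockPolynomial]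
    exact hasSum_inner_fock_smul f
  have h2 : HasSum (fun n => c n • ofPolynomial (X ^ 2 * fockPolynomial n)) f₂ := by
    have h := (hasSum_nat_add_iff' 2).2 (hasSum_inner_fock_smul f₂)
    have h0 : ∑ i ∈ Finset.range 2, (inner ℂ (fock i) f₂ : ℂ) • fock i = 0 :=
      Finset.sum_eq_zero fun i hi => by
        rw [inner_fock_of_eq_sq_mul_of_lt hf₂ (Finset.mem_range.1 hi), zero_smul]
    rw [h0, sub_zero] at h
    refine h.congr_fun fun n => ?_
    rw [ofPolynomial_sq_mul_fockPolynomial, inner_fock_of_eq_sq_mul hf₂, smul_smul, mul_comm]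
  have h3 : HasSum (fun n => c n • ofPolynomial (derivative (derivative (fockPolynomial n)))) f₃ := by
    refine (hasSum_nat_add_iff' 2).1 ?_
    have h0 : ∑ i ∈ Finset.range 2,
        c i • ofPolynomial (derivative (derivative (fockPolynomial i))) = 0 :=
      Finset.sum_eq_zero fun i hi => by
        rw [derivative_fockPolynomial_of_lt (Finset.mem_range.1 hi), map_zero, smul_zero]
    rw [h0, sub_zero]
    refine (hasSum_inner_fock_smul f₃).congr_fun fun n => ?_
    rw [ofPolynomial_derivative_fockPolynomial, inner_fock_of_eq_deriv_deriv hf₃, smul_smul,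
      mul_comm]
  have h4 := h1.prodMk ((h2.const_smul (ξ / 2)).sub (h3.const_smul (conj ξ / 2)))
  refine mem_closure_of_tendsto h4 (Filter.Eventually.of_forall fun s => ?_)
  refine Submodule.sum_mem _ fun n _ => ⟨c n • fockPolynomial n, ?_⟩
  refine Prod.ext (map_smul _ _ _) ?_
  change squeezeOnPolynomial ξ _ = _
  rw [map_smul, squeezeOnPolynomial_eq, smul_sub, smul_comm (c n), smul_comm (c n)]

end Bargmann

namespace Bargmann

open Filter Topology

/-! ### Gaussian functions -/

/-- The function `zᵏ exp (α z² + β z)`. -/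
def gaussianFun (k : ℕ) (α β z : ℂ) : ℂ := z ^ k * Complex.exp (α * z ^ 2 + β * z)

theorem differentiable_gaussianFun (k : ℕ) (α β : ℂ) : Differentiable ℂ (gaussianFun k α β) := by
  unfold gaussianFun
  fun_prop

/-- A bound uniform in `α` and `β`, serving both for membership in `L²` and for dominated
convergence. -/
theorem exists_norm_gaussianFun_le (k : ℕ) {a : ℝ} (ha : a < 1 / 2) (b : ℝ) :
    ∃ C, ∃ ρ < (1 / 2 : ℝ), ∀ α β z : ℂ, ‖α‖ ≤ a → ‖β‖ ≤ b →
      ‖gaussianFun k α β z‖ ≤ C * Real.exp (ρ * ‖z‖ ^ 2) := by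
  -- Half of the gap below `1 / 2` absorbs the linear exponent `(b + 1) ‖z‖`, whose extra `1` comes
  -- from `‖z‖ ^ k ≤ k! exp ‖z‖`.
  set δ : ℝ := (1 / 2 - a) / 2
  have hδ : 0 < δ := by simp only [δ]; linarith
  refine ⟨k.factorial * Real.exp ((b + 1) ^ 2 / (4 * δ)), a + δ, by simp only [δ]; linarith,
    fun α β z hα hβ => ?_⟩
  have h1 : ‖z‖ ^ k ≤ k.factorial * Real.exp ‖z‖ := by
    have := Real.pow_div_factorial_le_exp ‖z‖ (norm_nonneg z) k
    rwa [div_le_iff₀ (by positivity), mul_comm] at this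
  have h2 : (α * z ^ 2 + β * z).re ≤ a * ‖z‖ ^ 2 + b * ‖z‖ := by
    refine (Complex.re_le_norm _).trans ((norm_add_le _ _).trans ?_)
    rw [norm_mul, norm_mul, norm_pow]
    gcongr
  have h3 : (b + 1) * ‖z‖ ≤ (b + 1) ^ 2 / (4 * δ) + δ * ‖z‖ ^ 2 := by
    have h4 : (b + 1) ^ 2 / (4 * δ) + δ * ‖z‖ ^ 2 - (b + 1) * ‖z‖ =
        (b + 1 - 2 * δ * ‖z‖) ^ 2 / (4 * δ) := by
      field_simp
      ring
    have h5 : 0 ≤ (b + 1 - 2 * δ * ‖z‖) ^ 2 / (4 * δ) := by positivity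
    linarith
  rw [gaussianFun, norm_mul, norm_pow, Complex.norm_exp]
  calc ‖z‖ ^ k * Real.exp (α * z ^ 2 + β * z).re
      ≤ (k.factorial * Real.exp ‖z‖) * Real.exp (a * ‖z‖ ^ 2 + b * ‖z‖) := by gcongr
    _ = k.factorial * Real.exp (‖z‖ + (a * ‖z‖ ^ 2 + b * ‖z‖)) := by
      rw [Real.exp_add ‖z‖, mul_assoc]
    _ ≤ k.factorial * Real.exp ((b + 1) ^ 2 / (4 * δ) + (a + δ) * ‖z‖ ^ 2) := by
      refine mul_le_mul_of_nonneg_left (Real.exp_le_exp.2 ?_) (by positivity)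
      linarith
    _ = _ := by rw [Real.exp_add, mul_assoc]

theorem memLp_exp_mul_sq {ρ : ℝ} (hρ : ρ < 1 / 2) :
    MemLp (fun z : ℂ => Real.exp (ρ * ‖z‖ ^ 2)) 2 bargmannMeasure := by
  rw [memLp_two_iff_integrable_sq_norm (by fun_prop), bargmannMeasure,
    integrable_withDensity_iff (by fun_prop) (ae_of_all _ fun z => ENNReal.ofReal_lt_top)]
  have h1 : Integrable (fun z : ℂ => Real.exp (-(1 - 2 * ρ) * ‖z‖ ^ 2)) := by
    have h := (GaussianFourier.integrable_cexp_neg_mul_sq_norm_add (V := ℂ)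
      (b := ((1 - 2 * ρ : ℝ) : ℂ)) (by rw [Complex.ofReal_re]; linarith) 0 0).norm
    refine h.congr (ae_of_all _ fun z => ?_)
    simp [Complex.norm_exp, ← Complex.ofReal_pow]
  refine (h1.const_mul Real.pi⁻¹).congr (ae_of_all _ fun z => ?_)
  simp only
  rw [ENNReal.toReal_ofReal (by positivity), Real.norm_eq_abs, sq_abs, ← Real.exp_nat_mul,
    mul_left_comm, ← Real.exp_add]
  congr 2
  push_cast
  ring

theorem memLp_gaussianFun (k : ℕ) {α : ℂ} (hα : ‖α‖ < 1 / 2) (β : ℂ) :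
    MemLp (gaussianFun k α β) 2 bargmannMeasure := by
  obtain ⟨C, ρ, hρ, h⟩ := exists_norm_gaussianFun_le k hα ‖β‖
  refine (memLp_exp_mul_sq hρ).of_le_mul (c := C)
    (differentiable_gaussianFun k α β).continuous.aestronglyMeasurable (ae_of_all _ fun z => ?_)
  rw [Real.norm_of_nonneg (Real.exp_nonneg _)]
  exact h α β z le_rfl le_rfl

open Classical in
/-- The function `zᵏ exp (α z² + β z)` as an element of the Bargmann space, for `‖α‖ < 1 / 2`. -/
def gaussian (k : ℕ) (α β : ℂ) : Bargmann :=
  if h : ‖α‖ < 1 / 2 then mk _ (differentiable_gaussianFun k α β) (memLp_gaussianFun k h β) else 0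

theorem gaussian_apply (k : ℕ) {α : ℂ} (hα : ‖α‖ < 1 / 2) (β z : ℂ) :
    gaussian k α β z = gaussianFun k α β z := by
  rw [gaussian, dif_pos hα, mk_apply]

theorem norm_sq_eq_integral (f : Bargmann) : ‖f‖ ^ 2 = ∫ z, ‖f z‖ ^ 2 ∂bargmannMeasure := by
  rw [@norm_sq_eq_re_inner ℂ, inner_eq_integral]
  have h : ∀ z, conj (f z) * f z = ((‖f z‖ ^ 2 : ℝ) : ℂ) := fun z => by
    rw [Complex.conj_mul']
    push_cast
    rfl
  simp only [h]
  rw [integral_complex_ofReal]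
  rfl

theorem continuous_gaussian (k : ℕ) {X : Type*} [TopologicalSpace X] [FirstCountableTopology X]
    {α β : X → ℂ} (hα : Continuous α) (hβ : Continuous β) (hα' : ∀ t, ‖α t‖ < 1 / 2) :
    Continuous fun t => gaussian k (α t) (β t) := by
  refine continuous_iff_continuousAt.2 fun t₀ => ?_
  obtain ⟨a, ha, ha'⟩ := exists_between (hα' t₀)
  obtain ⟨C, ρ, hρ, hC⟩ := exists_norm_gaussianFun_le k ha' (‖β t₀‖ + 1)
  have h1 : ∀ᶠ t in 𝓝 t₀, ‖α t‖ ≤ a :=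
    (hα.norm.continuousAt.eventually_lt_const ha).mono fun t => le_of_lt
  have h2 : ∀ᶠ t in 𝓝 t₀, ‖β t‖ ≤ ‖β t₀‖ + 1 :=
    (hβ.norm.continuousAt.eventually_lt_const (lt_add_one _)).mono fun t => le_of_lt
  rw [ContinuousAt, tendsto_iff_norm_sub_tendsto_zero]
  have h3 : Tendsto (fun t => ‖gaussian k (α t) (β t) - gaussian k (α t₀) (β t₀)‖ ^ 2) (𝓝 t₀)
      (𝓝 0) := by
    simp only [norm_sq_eq_integral]
    have h4 : (0 : ℝ) = ∫ _ : ℂ, (0 : ℝ) ∂bargmannMeasure := by simp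
    rw [h4]
    refine tendsto_integral_filter_of_dominated_convergence
      (fun z => (2 * C) ^ 2 * Real.exp (ρ * ‖z‖ ^ 2) ^ 2) (Eventually.of_forall fun t => ?_) ?_
      ((memLp_exp_mul_sq hρ).integrable_sq.const_mul _) (ae_of_all _ fun z => ?_)
    · exact ((gaussian k (α t) (β t) - gaussian k (α t₀) (β t₀)).differentiable.continuous.norm.pow
        2).aestronglyMeasurable
    · filter_upwards [h1, h2] with t ht1 ht2
      refine ae_of_all _ fun z => ?_
      rw [Real.norm_of_nonneg (by positivity), ← mul_pow, sub_apply, gaussian_apply k (hα' t),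
        gaussian_apply k (hα' t₀)]
      refine pow_le_pow_left₀ (norm_nonneg _) ((norm_sub_le _ _).trans ?_) 2
      linarith [hC _ _ z ht1 ht2, hC _ _ z ha.le (le_add_of_nonneg_right zero_le_one)]
    · simp only [sub_apply, gaussian_apply k (hα' _)]
      have h5 : Continuous fun t => ‖gaussianFun k (α t) (β t) z -
          gaussianFun k (α t₀) (β t₀) z‖ ^ 2 := by
        unfold gaussianFun
        fun_prop
      simpa using h5.tendsto t₀
  simpa using h3.sqrt

/-- A pointwise derivative which is continuous in norm is a derivative in norm. -/
theorem hasDerivAt_of_forall_apply {F F' : ℝ → Bargmann} (hc : Continuous F')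
    (h : ∀ t z, HasDerivAt (fun t => F t z) (F' t z) t) (t : ℝ) : HasDerivAt F (F' t) t := by
  -- Pairing with the reproducing kernels reduces this to the scalar fundamental theorem of calculus
  -- at each point.
  have key : ∀ t, F t = F 0 + ∫ s in (0 : ℝ)..t, F' s := by
    intro t
    refine ext_inner_kernel fun z => ?_
    have h1 := (innerSL ℂ (kernel z)).intervalIntegral_comp_comm
      (hc.intervalIntegrable (μ := volume) 0 t)
    have hc' : Continuous fun s => F' s z := by
      simp only [← inner_kernel z]
      fun_prop
    have h2 := intervalIntegral.integral_eq_sub_of_hasDerivAt (a := 0) (b := t)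
      (fun s _ => h s z) (hc'.intervalIntegrable _ _)
    simp only [innerSL_apply_apply, inner_kernel] at h1
    rw [inner_add_right, ← innerSL_apply_apply ℂ (kernel z) (∫ s in (0 : ℝ)..t, F' s)]
    simp only [inner_kernel, innerSL_apply_apply] at h1 ⊢
    rw [← h1, h2]
    ring
  have h3 : HasDerivAt (fun t => F 0 + ∫ s in (0 : ℝ)..t, F' s) (F' t) t :=
    (intervalIntegral.integral_hasDerivAt_right (hc.intervalIntegrable _ _)
      (hc.stronglyMeasurableAtFilter _ _) hc.continuousAt).const_add _
  exact h3.congr_of_eventuallyEq (Eventually.of_forall key)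

end Bargmann

namespace Bargmann

/-! ### The evolution of the reproducing kernels -/

theorem deriv_deriv_gaussianFun (α β z : ℂ) :
    deriv (deriv (gaussianFun 0 α β)) z = (2 * α + β ^ 2) * gaussianFun 0 α β z +
      4 * α * β * gaussianFun 1 α β z + 4 * α ^ 2 * gaussianFun 2 α β z := by
  have h1 : ∀ z, HasDerivAt (fun z : ℂ => α * z ^ 2 + β * z) (2 * α * z + β) z := fun z => by
    refine (((hasDerivAt_pow 2 z).const_mul α).add ((hasDerivAt_id z).const_mul β)).congr_deriv ?_
    simp
    ring
  have h2 : deriv (gaussianFun 0 α β) =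
      fun z => Complex.exp (α * z ^ 2 + β * z) * (2 * α * z + β) := by
    ext z
    have h : gaussianFun 0 α β = fun z => Complex.exp (α * z ^ 2 + β * z) := by
      ext z
      simp [gaussianFun]
    rw [h]
    exact (h1 z).cexp.deriv
  have h3 : HasDerivAt (fun z : ℂ => 2 * α * z + β) (2 * α) z := by
    simpa using ((hasDerivAt_id z).const_mul (2 * α)).add_const β
  rw [h2]
  refine ((h1 z).cexp.mul h3).deriv.trans ?_
  simp only [gaussianFun]
  ring

/-- The unit complex number `ξ / ‖ξ‖`, which is `0` for `ξ = 0`. -/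
def phase (ξ : ℂ) : ℂ := ξ / ‖ξ‖

theorem norm_mul_phase (ξ : ℂ) : (‖ξ‖ : ℂ) * phase ξ = ξ := by
  rcases eq_or_ne ξ 0 with rfl | h
  · simp
  · have : (‖ξ‖ : ℂ) ≠ 0 := by simpa using h
    rw [phase]
    field_simp

theorem conj_mul_phase (ξ : ℂ) : conj ξ * phase ξ = ‖ξ‖ := by
  rcases eq_or_ne ξ 0 with rfl | h
  · simp
  · have : (‖ξ‖ : ℂ) ≠ 0 := by simpa using h
    rw [phase, ← mul_div_assoc, Complex.conj_mul', sq]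
    field_simp

theorem norm_phase_le (ξ : ℂ) : ‖phase ξ‖ ≤ 1 := by
  rw [phase, norm_div, Complex.norm_real, norm_norm]
  exact div_self_le_one _

theorem abs_tanh_lt_one (x : ℝ) : |Real.tanh x| < 1 :=
  abs_lt.2 ⟨Real.neg_one_lt_tanh x, Real.tanh_lt_one x⟩

theorem continuous_tanh : Continuous Real.tanh := by
  simp only [funext Real.tanh_eq_sinh_div_cosh]
  exact Real.continuous_sinh.div₀ Real.continuous_cosh fun x => (Real.cosh_pos x).ne'

theorem one_sub_tanh_sq (x : ℝ) : 1 - Real.tanh x ^ 2 = (Real.cosh x)⁻¹ ^ 2 := by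
  have := (Real.cosh_pos x).ne'
  rw [Real.tanh_eq_sinh_div_cosh]
  field_simp
  rw [Real.cosh_sq]
  ring

/-- The coefficient of `z²` in the exponent of the evolved kernel. -/
def quadCoeff (ξ : ℂ) (t : ℝ) : ℂ := Real.tanh (t * ‖ξ‖) / 2 * phase ξ

/-- The coefficient of `z` in the exponent of the evolved kernel. -/
def linCoeff (ξ w : ℂ) (t : ℝ) : ℂ := ((Real.cosh (t * ‖ξ‖))⁻¹ : ℝ) * conj w

/-- The constant term in the exponent of the evolved kernel. -/
def constCoeff (ξ w : ℂ) (t : ℝ) : ℂ :=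
  -(Real.log (Real.cosh (t * ‖ξ‖)) / 2) - Real.tanh (t * ‖ξ‖) / 2 * conj (phase ξ) * conj w ^ 2

/-- This keeps the evolved kernel square integrable for all times. -/
theorem norm_quadCoeff_lt (ξ : ℂ) (t : ℝ) : ‖quadCoeff ξ t‖ < 1 / 2 := by
  rw [quadCoeff, norm_mul, norm_div, Complex.norm_real, Complex.norm_ofNat, Real.norm_eq_abs]
  have h1 := abs_tanh_lt_one (t * ‖ξ‖)
  have h2 := norm_phase_le ξ
  have h3 := norm_nonneg (phase ξ)
  nlinarith [abs_nonneg (Real.tanh (t * ‖ξ‖))]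

theorem continuous_quadCoeff (ξ : ℂ) : Continuous (quadCoeff ξ) := by
  have h := continuous_tanh
  unfold quadCoeff
  fun_prop

theorem continuous_linCoeff (ξ w : ℂ) : Continuous (linCoeff ξ w) := by
  have h : Continuous fun t : ℝ => (Real.cosh (t * ‖ξ‖))⁻¹ :=
    (Real.continuous_cosh.comp (by fun_prop)).inv₀ fun t => (Real.cosh_pos _).ne'
  exact (Complex.continuous_ofReal.comp h).mul continuous_const

theorem continuous_constCoeff (ξ w : ℂ) : Continuous (constCoeff ξ w) := by
  have h := continuous_tanh
  have h2 : Continuous fun t : ℝ => Real.log (Real.cosh (t * ‖ξ‖)) :=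
    (Real.continuous_cosh.comp (by fun_prop)).log fun t => (Real.cosh_pos _).ne'
  unfold constCoeff
  fun_prop

theorem hasDerivAt_mul_norm (ξ : ℂ) (t : ℝ) : HasDerivAt (fun t : ℝ => t * ‖ξ‖) ‖ξ‖ t := by
  simpa using (hasDerivAt_id t).mul_const ‖ξ‖

theorem hasDerivAt_cosh_mul_norm (ξ : ℂ) (t : ℝ) :
    HasDerivAt (fun t : ℝ => Real.cosh (t * ‖ξ‖)) (Real.sinh (t * ‖ξ‖) * ‖ξ‖) t :=
  (hasDerivAt_mul_norm ξ t).cosh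

theorem hasDerivAt_tanh_mul_norm (ξ : ℂ) (t : ℝ) :
    HasDerivAt (fun t : ℝ => Real.tanh (t * ‖ξ‖)) ((Real.cosh (t * ‖ξ‖))⁻¹ ^ 2 * ‖ξ‖) t := by
  have h0 := (Real.cosh_pos (t * ‖ξ‖)).ne'
  simp only [Real.tanh_eq_sinh_div_cosh]
  refine ((hasDerivAt_mul_norm ξ t).sinh.div (hasDerivAt_cosh_mul_norm ξ t) h0).congr_deriv ?_
  field_simp
  rw [Real.cosh_sq]
  ring

theorem hasDerivAt_inv_cosh_mul_norm (ξ : ℂ) (t : ℝ) :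
    HasDerivAt (fun t : ℝ => (Real.cosh (t * ‖ξ‖))⁻¹)
      (-(Real.tanh (t * ‖ξ‖) * (Real.cosh (t * ‖ξ‖))⁻¹ * ‖ξ‖)) t := by
  have h0 := (Real.cosh_pos (t * ‖ξ‖)).ne'
  refine ((hasDerivAt_cosh_mul_norm ξ t).inv h0).congr_deriv ?_
  rw [Real.tanh_eq_sinh_div_cosh]
  field_simp

theorem hasDerivAt_log_cosh_mul_norm (ξ : ℂ) (t : ℝ) :
    HasDerivAt (fun t : ℝ => Real.log (Real.cosh (t * ‖ξ‖))) (Real.tanh (t * ‖ξ‖) * ‖ξ‖) t := by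
  have h0 := (Real.cosh_pos (t * ‖ξ‖)).ne'
  refine ((hasDerivAt_cosh_mul_norm ξ t).log h0).congr_deriv ?_
  rw [Real.tanh_eq_sinh_div_cosh]
  field_simp

/-- The function `zᵏ` times the evolved kernel. -/
def evolvedMoment (ξ : ℂ) (k : ℕ) (t : ℝ) (w : ℂ) : Bargmann :=
  Complex.exp (constCoeff ξ w t) • gaussian k (quadCoeff ξ t) (linCoeff ξ w t)

/-- The evolution at time `t` of the reproducing kernel at `w`. -/
def evolvedKernel (ξ : ℂ) (t : ℝ) (w : ℂ) : Bargmann := evolvedMoment ξ 0 t w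

/-- The second derivative of the evolved kernel. -/
def evolvedKernelDeriv₂ (ξ : ℂ) (t : ℝ) (w : ℂ) : Bargmann :=
  (2 * quadCoeff ξ t + linCoeff ξ w t ^ 2) • evolvedMoment ξ 0 t w +
    (4 * quadCoeff ξ t * linCoeff ξ w t) • evolvedMoment ξ 1 t w +
    (4 * quadCoeff ξ t ^ 2) • evolvedMoment ξ 2 t w

/-- The time derivative of the evolved kernel. -/
def evolvedKernelDot (ξ : ℂ) (t : ℝ) (w : ℂ) : Bargmann :=
  (ξ / 2) • evolvedMoment ξ 2 t w - (conj ξ / 2) • evolvedKernelDeriv₂ ξ t w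

theorem evolvedMoment_apply (ξ : ℂ) (k : ℕ) (t : ℝ) (w z : ℂ) :
    evolvedMoment ξ k t w z = Complex.exp (constCoeff ξ w t) *
      gaussianFun k (quadCoeff ξ t) (linCoeff ξ w t) z := by
  rw [evolvedMoment, smul_apply, gaussian_apply k (norm_quadCoeff_lt ξ t)]

theorem evolvedMoment_apply_eq_pow_mul (ξ : ℂ) (k : ℕ) (t : ℝ) (w z : ℂ) :
    evolvedMoment ξ k t w z = z ^ k * evolvedKernel ξ t w z := by
  rw [evolvedKernel, evolvedMoment_apply, evolvedMoment_apply]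
  simp only [gaussianFun]
  ring

theorem evolvedKernelDeriv₂_apply (ξ : ℂ) (t : ℝ) (w z : ℂ) :
    evolvedKernelDeriv₂ ξ t w z = (2 * quadCoeff ξ t + linCoeff ξ w t ^ 2 +
      4 * quadCoeff ξ t * linCoeff ξ w t * z + 4 * quadCoeff ξ t ^ 2 * z ^ 2) *
        evolvedKernel ξ t w z := by
  rw [evolvedKernelDeriv₂, add_apply, add_apply, smul_apply, smul_apply, smul_apply,
    evolvedMoment_apply_eq_pow_mul, evolvedMoment_apply_eq_pow_mul, evolvedMoment_apply_eq_pow_mul]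
  ring

theorem evolvedKernelDeriv₂_eq (ξ : ℂ) (t : ℝ) (w z : ℂ) :
    evolvedKernelDeriv₂ ξ t w z = deriv (deriv (evolvedKernel ξ t w)) z := by
  have h : (evolvedKernel ξ t w : ℂ → ℂ) = fun z => Complex.exp (constCoeff ξ w t) *
      gaussianFun 0 (quadCoeff ξ t) (linCoeff ξ w t) z :=
    funext fun z => evolvedMoment_apply ξ 0 t w z
  have h2 : deriv (evolvedKernel ξ t w) = fun z => Complex.exp (constCoeff ξ w t) *
      deriv (gaussianFun 0 (quadCoeff ξ t) (linCoeff ξ w t)) z := by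
    rw [h]
    exact funext fun z => deriv_const_mul_field _
  rw [h2, deriv_const_mul_field, deriv_deriv_gaussianFun, evolvedKernelDeriv₂, add_apply, add_apply,
    smul_apply, smul_apply, smul_apply, evolvedMoment_apply, evolvedMoment_apply,
    evolvedMoment_apply]
  ring

theorem evolvedKernel_apply (ξ : ℂ) (t : ℝ) (w z : ℂ) :
    evolvedKernel ξ t w z = Complex.exp (constCoeff ξ w t + quadCoeff ξ t * z ^ 2 +
      linCoeff ξ w t * z) := by
  rw [evolvedKernel, evolvedMoment_apply, gaussianFun, pow_zero, one_mul, ← Complex.exp_add,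
    add_assoc]

theorem evolvedKernel_zero (ξ : ℂ) : evolvedKernel ξ 0 = kernel := by
  ext w z
  rw [evolvedKernel_apply, kernel_apply]
  simp [constCoeff, quadCoeff, linCoeff, mul_comm]

/-- Comparing powers of `z`, with `q`, `l`, `c` the three coefficients, this is the Riccati system
`q' = ξ / 2 - 2 conj ξ q²`, `l' = -2 conj ξ q l`, `c' = -(conj ξ / 2) (2 q + l²)`. -/
theorem hasDerivAt_evolvedKernel_apply (ξ w : ℂ) (t : ℝ) (z : ℂ) :
    HasDerivAt (fun t => evolvedKernel ξ t w z) (evolvedKernelDot ξ t w z) t := by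
  have hτ := (hasDerivAt_tanh_mul_norm ξ t).ofReal_comp
  have hσ := (hasDerivAt_inv_cosh_mul_norm ξ t).ofReal_comp
  have hl := (hasDerivAt_log_cosh_mul_norm ξ t).ofReal_comp
  have hq : HasDerivAt (quadCoeff ξ) _ t := (hτ.div_const 2).mul_const (phase ξ)
  have hlin : HasDerivAt (linCoeff ξ w) _ t := hσ.mul_const (conj w)
  have hc : HasDerivAt (constCoeff ξ w) _ t :=
    (hl.div_const 2).neg.sub (((hτ.div_const 2).mul_const (conj (phase ξ))).mul_const (conj w ^ 2))
  have h := ((hc.add (hq.mul_const (z ^ 2))).add (hlin.mul_const z)).cexp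
  have h1 : (fun t => evolvedKernel ξ t w z) = fun t => Complex.exp (constCoeff ξ w t +
      quadCoeff ξ t * z ^ 2 + linCoeff ξ w t * z) := funext fun t => evolvedKernel_apply ξ t w z
  rw [h1]
  refine h.congr_deriv ?_
  rw [evolvedKernelDot, sub_apply, smul_apply, smul_apply, evolvedKernelDeriv₂_apply,
    evolvedMoment_apply_eq_pow_mul, evolvedKernel_apply]
  have hs : (1 : ℂ) - (Real.tanh (t * ‖ξ‖) : ℂ) ^ 2 = (((Real.cosh (t * ‖ξ‖))⁻¹ : ℝ) : ℂ) ^ 2 := by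
    exact_mod_cast one_sub_tanh_sq (t * ‖ξ‖)
  have hξ := norm_mul_phase ξ
  have hξ' : (‖ξ‖ : ℂ) * conj (phase ξ) = conj ξ := by
    rw [← Complex.conj_ofReal, ← map_mul, norm_mul_phase]
  have hu := conj_mul_phase ξ
  simp only [Pi.add_apply]
  set E := Complex.exp (constCoeff ξ w t + quadCoeff ξ t * z ^ 2 + linCoeff ξ w t * z)
  simp only [quadCoeff, linCoeff]
  simp only [Complex.ofReal_mul, Complex.ofReal_neg, Complex.ofReal_pow]
  -- What remains is a polynomial identity modulo `1 - T² = s²`, `r u = ξ`, `r v = Y` and `Y u = r`,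
  -- all valid also for `ξ = 0`.
  generalize (((Real.cosh (t * ‖ξ‖))⁻¹ : ℝ) : ℂ) = s at *
  generalize (Real.tanh (t * ‖ξ‖) : ℂ) = T at *
  generalize (‖ξ‖ : ℂ) = r at *
  generalize conj (phase ξ) = v at *
  generalize phase ξ = u at *
  generalize conj ξ = Y at *
  generalize conj w = w' at *
  linear_combination E * (1 / 2 * z ^ 2 * hξ - 1 / 2 * s ^ 2 * w' ^ 2 * hξ' +
    1 / 2 * (T + 2 * T * s * w' * z + T ^ 2 * u * z ^ 2) * hu - 1 / 2 * r * u * z ^ 2 * hs)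

theorem continuous_evolvedMoment (ξ : ℂ) (k : ℕ) (w : ℂ) :
    Continuous fun t => evolvedMoment ξ k t w :=
  (Complex.continuous_exp.comp (continuous_constCoeff ξ w)).smul
    (continuous_gaussian k (continuous_quadCoeff ξ) (continuous_linCoeff ξ w) (norm_quadCoeff_lt ξ))

theorem continuous_evolvedKernelDot (ξ w : ℂ) : Continuous fun t => evolvedKernelDot ξ t w := by
  have h1 := continuous_quadCoeff ξ
  have h2 := continuous_linCoeff ξ w
  have h3 := continuous_evolvedMoment ξ 0 w
  have h4 := continuous_evolvedMoment ξ 1 w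
  have h5 := continuous_evolvedMoment ξ 2 w
  unfold evolvedKernelDot evolvedKernelDeriv₂
  fun_prop

theorem isSkewFlow_evolvedKernel (ξ : ℂ) :
    IsSkewFlow (squeezeSubmodule ξ) (evolvedKernel ξ) (evolvedKernelDot ξ) where
  skew := isSkewGraph_squeezeSubmodule ξ
  hasDerivAt t w := hasDerivAt_of_forall_apply (continuous_evolvedKernelDot ξ w)
    (hasDerivAt_evolvedKernel_apply ξ w) t
  continuous_deriv := continuous_evolvedKernelDot ξ
  mem t w := mem_closure_squeezeSubmodule ξ (evolvedMoment_apply_eq_pow_mul ξ 2 t w)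
    (evolvedKernelDeriv₂_eq ξ t w)
  dense := by
    rw [evolvedKernel_zero]
    exact dense_span_kernel

/-! ### The squeeze operator -/

theorem norm_squeezeParam (ξ : ℂ) : ‖squeezeParam ξ‖ = |Real.tanh ‖ξ‖| := by
  rw [squeezeParam, norm_mul, Complex.norm_real, Real.norm_eq_abs, abs_div, abs_norm]
  rcases eq_or_ne ξ 0 with rfl | h
  · simp
  · have : ‖ξ‖ ≠ 0 := by simpa using h
    field_simp

theorem squeezeParam_eq (ξ : ℂ) : squeezeParam ξ = Real.tanh ‖ξ‖ * phase ξ := by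
  rw [squeezeParam, phase]
  push_cast
  ring

theorem squeezeKernel_eq (ξ z w : ℂ) : squeezeKernel ξ z w = evolvedKernel ξ 1 w z := by
  have hpos := Real.cosh_pos ‖ξ‖
  have h1 : 1 - ‖squeezeParam ξ‖ ^ 2 = (Real.cosh ‖ξ‖)⁻¹ ^ 2 := by
    rw [norm_squeezeParam, sq_abs, one_sub_tanh_sq]
  -- As `1 - ‖ζ‖² = 1 / cosh² ‖ξ‖`, the prefactor is `cosh ‖ξ‖` to the power `-1 / 2`, the real part
  -- of the constant term at `w = 0`, exponentiated.
  have h2 : (((Real.cosh ‖ξ‖)⁻¹ ^ 2) ^ (1 / 4 : ℝ) : ℝ) =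
      Real.exp (-(Real.log (Real.cosh ‖ξ‖) / 2)) := by
    rw [Real.rpow_def_of_pos (by positivity), Real.log_pow, Real.log_inv]
    congr 1
    push_cast
    ring
  rw [squeezeKernel, h1, h2, Real.sqrt_sq (by positivity), evolvedKernel_apply, squeezeParam_eq,
    Complex.ofReal_exp, ← Complex.exp_add, ← Complex.exp_add]
  congr 1
  simp only [constCoeff, quadCoeff, linCoeff, one_mul, map_mul, Complex.conj_ofReal]
  push_cast
  ring

theorem isUnitaryExp_squeeze (ξ : ℂ) : IsUnitaryExp (squeezeGenerator ξ) (squeeze ξ) := by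
  have h : ∃ S, IsUnitaryExp (squeezeGenerator ξ) S :=
    ⟨_, coe_squeezeSubmodule ξ ▸ (isSkewFlow_evolvedKernel ξ).isUnitaryExp⟩
  rw [squeeze, unitaryExp, dif_pos h]
  exact h.choose_spec

theorem squeeze_kernel_apply (ξ z w : ℂ) : squeeze ξ (kernel w) z = squeezeKernel ξ z w := by
  have h := isUnitaryExp_squeeze ξ
  rw [← coe_squeezeSubmodule] at h
  have h2 := (isSkewFlow_evolvedKernel ξ).apply_of_isUnitaryExp h w
  rw [evolvedKernel_zero] at h2
  rw [h2, squeezeKernel_eq]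

/-- Both sides equal `⟪k_z, S k_w⟫`. As a function of `w` the kernel is thus the conjugate of a
Bargmann function, which makes its product with any `f` in the space integrable. -/
theorem squeezeKernel_eq_conj (ξ z w : ℂ) :
    squeezeKernel ξ z w = conj ((squeeze ξ).symm (kernel z) w) := by
  rw [← squeeze_kernel_apply, ← inner_kernel z, ← inner_kernel w,
    inner_conj_symm, ← LinearIsometryEquiv.inner_map_map (squeeze ξ) ((squeeze ξ).symm _),
    LinearIsometryEquiv.apply_symm_apply]

theorem coherentState_eq (w : ℂ) :
    coherentState w = (Real.exp (-‖w‖ ^ 2 / 2) : ℂ) • kernel w := rfl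

end Bargmann

theorem mainTheorem6 (ξ : ℂ) :
    (∃! S : Bargmann ≃ₗᵢ[ℂ] Bargmann, IsUnitaryExp (Bargmann.squeezeGenerator ξ) S) ∧
    (∀ (f : Bargmann) (z : ℂ),
      Integrable (fun w => Bargmann.squeezeKernel ξ z w * f w) bargmannMeasure ∧
      Bargmann.squeeze ξ f z = ∫ w, Bargmann.squeezeKernel ξ z w * f w ∂bargmannMeasure) ∧
    (∀ z w : ℂ, HasSum (fun n : ℕ => Bargmann.squeezedFock ξ n z * conj (Bargmann.fock n w))
      (Bargmann.squeezeKernel ξ z w)) ∧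
    (∀ w : ℂ, Summable (fun n : ℕ => conj (Bargmann.fock n w) • Bargmann.fock n) ∧
      ∀ z : ℂ, Bargmann.squeezedCoherentState ξ w z =
        (Real.exp (-‖w‖ ^ 2 / 2) : ℂ) * Bargmann.squeezeKernel ξ z w) := by
  refine ⟨⟨_, Bargmann.isUnitaryExp_squeeze ξ, fun T hT => ?_⟩, fun f z => ?_, fun z w => ?_,
    fun w => ⟨Bargmann.summable_kernel w, fun z => ?_⟩⟩
  · have hS := Bargmann.isUnitaryExp_squeeze ξ
    rw [← Bargmann.coe_squeezeSubmodule] at hS hT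
    exact (Bargmann.isSkewFlow_evolvedKernel ξ).unique hT hS
  · simp only [Bargmann.squeezeKernel_eq_conj]
    refine ⟨Bargmann.integrable_conj_mul _ f, ?_⟩
    -- The integral is `⟪S⁻¹ k_z, f⟫ = ⟪k_z, S f⟫`, the value of `S f` at `z`.
    rw [← Bargmann.inner_eq_integral, ← LinearIsometryEquiv.inner_map_map (Bargmann.squeeze ξ),
      LinearIsometryEquiv.apply_symm_apply, Bargmann.inner_kernel]
  -- The continuous functional `⟪k_z, S ·⟫` is applied to the Fock series of `k_w`.
  · have h := (Bargmann.hasSum_kernel w).map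
      ((innerSL ℂ (Bargmann.kernel z)).comp (Bargmann.squeeze ξ : Bargmann →L[ℂ] Bargmann))
      (ContinuousLinearMap.continuous _)
    rw [← Bargmann.squeeze_kernel_apply, ← Bargmann.inner_kernel z]
    refine h.congr_fun fun n => ?_
    change _ = inner ℂ (Bargmann.kernel z) (Bargmann.squeeze ξ _)
    rw [map_smul, inner_smul_right, Bargmann.inner_kernel, mul_comm]
    rfl
  · rw [Bargmann.squeezedCoherentState, Bargmann.coherentState_eq, map_smul, Bargmann.smul_apply,
      Bargmann.squeeze_kernel_apply]

end
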